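/- Let $X$ and $Y$ be Polish spaces with non-atomic Borel probability measures $\mu$ and $\nu$, and let $T: X \to X$ and $S: Y \to Y$ be homeomorphisms that preserve $\mu$ and $\nu$, respectively, and are ergodic. Then there are a $T$-invariant $G_\delta$ set $X' \subset X$ and an $S$-invariant $G_\delta$ set $Y' \subset Y$, both of full measure, and a homeomorphism $\varphi: X' \to Y'$ such that $\varphi_*(\mu|_{X'}) = \nu|_{Y'}$ and $\varphi$ maps $T$-orbits onto $S$-orbits, that is, $\varphi(\{T^n x : n \in \mathbb{Z}\}) = \{S^n \varphi(x) : n \in \mathbb{Z}\}$ for every $x \in X'$. In particular, call a topological space fractured if its topology has a countable base consisting of clopen sets; then the same conclusion holds under the additional hypothesis that $X$ and $Y$ are fractured. -/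

import Mathlib

open Set MeasureTheory TopologicalSpace

universe u v

/-- A topological space is fractured if its topology has a countable base of clopen sets. -/
def IsFractured (X : Type*) [TopologicalSpace X] : Prop :=
  ∃ B : Set (Set X), B.Countable ∧ IsTopologicalBasis B ∧ ∀ U ∈ B, IsClopen U

/-- The full (two-sided) orbit of a point `x` under a homeomorphism `T`. -/
def homeoOrbit {X : Type*} [TopologicalSpace X] (T : X ≃ₜ X) (x : X) : Set X :=
  {z | ∃ n : ℤ, (T ^ n) x = z}

/-- `X'` is a `T`-invariant `G_δ` subset of full measure. -/
structure IsInvariantGdeltaFull {X : Type*} [TopologicalSpace X] [MeasurableSpace X]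
    (T : X ≃ₜ X) (μ : Measure X) (X' : Set X) : Prop where
  isGδ : IsGδ X'
  invariant : T '' X' = X'
  full : μ X'ᶜ = 0

/-- Almost continuous orbit equivalence: after removing invariant null sets, there is a
homeomorphism between the remaining invariant `G_δ` sets which carries the restriction of `μ` to
the restriction of `ν` and carries every `T`-orbit exactly onto an `S`-orbit. -/
def AlmostContinuousOrbitEquivalent {X Y : Type*}
    [TopologicalSpace X] [MeasurableSpace X] [TopologicalSpace Y] [MeasurableSpace Y]
    (T : X ≃ₜ X) (μ : Measure X) (S : Y ≃ₜ Y) (ν : Measure Y) : Prop :=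
  ∃ (X' : Set X) (Y' : Set Y) (φ : X' ≃ₜ Y'),
    IsInvariantGdeltaFull T μ X' ∧ IsInvariantGdeltaFull S ν Y' ∧
    MeasurePreserving φ (μ.comap ((↑) : X' → X)) (ν.comap ((↑) : Y' → Y)) ∧
    ∀ x : X', (fun z : X' => (φ z : Y)) '' {z : X' | (z : X) ∈ homeoOrbit T (x : X)} =
      homeoOrbit S (φ x : Y)

/-!
Both systems are compared with the same model, the space `ℕ → Bool` of binary sequences with the
fair coin measure and the relation of eventual equality. It suffices to code each system by the
model, i.e. to find, on an invariant `G_δ` set of full measure, an embedding into `ℕ → Bool` which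
carries orbits onto classes of eventual equality and the measure to the fair coin measure
(`exists_isCoding`); two codings are then composed, on the points whose codes both systems share
(`IsCoding.almostContinuousOrbitEquivalent`). The hypothesis that the spaces are fractured is not
needed, since every Polish space with a finite measure has a base of open sets with null frontier,
and such sets serve as clopen sets.

The coding is the limit of a sequence of stages. A stage is a finite subrelation of the orbit
relation whose classes are enumerated by the binary words of some length, together with a partition
into the sets of points with a given word (`OrbitSystem`, `Stage`). Each stage refines the previous
one: it is obtained by a finite relation on one set of the previous partition, transported to the
other sets (`OrbitSystem.prod`). Two kinds of refinement alternate. The first makes most sets of the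
partition lie inside or outside of a given set of the base (`exists_refinement_decides`); it cuts a
set into equal pieces by the levels of an injective function (`exists_equal_cut`), and ergodicity
provides maps between pieces of equal measure (`exists_partialIso`). The second makes most points
`x` related to `T x` (`exists_refinement_related`); it uses a Rokhlin tower for the first return map
to a set of the partition (`exists_block_system`). In the limit the words of a point determine
the point together with its neighbourhoods, and points on the same orbit have words which differ in
finitely many letters.

Almost continuity is kept throughout by working only with functions which are locally constant
at almost every point (`AELocConst`), and maps which near almost every point are a power of `T`
(`AELocPow`). Identities between them which hold almost everywhere automatically hold on
open sets of full measure, because almost every point is aperiodic (`AELocPow.eventually_eq`). The countably many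
open sets of full measure needed at the end are intersected to an invariant `G_δ` set
(`exists_invariantGdeltaFull`).
-/

open Filter Topology

-- The lemmas share one block of section variables, although some need only a part of it.
set_option linter.unusedSectionVars false

/-! ### Almost everywhere locally constant functions and local powers of a homeomorphism -/

section Basics

variable {X : Type*} [TopologicalSpace X] [MeasurableSpace X] [BorelSpace X]
  {μ : Measure X} {T : X ≃ₜ X} {α β γ : Type*}

lemma homeo_zpow_add_apply (T : X ≃ₜ X) (m n : ℤ) (x : X) :
    (T ^ (m + n)) x = (T ^ m) ((T ^ n) x) := by
  rw [zpow_add]; rfl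

lemma homeo_zpow_neg_apply (T : X ≃ₜ X) (n : ℤ) (x : X) : (T ^ (-n)) ((T ^ n) x) = x := by
  rw [← homeo_zpow_add_apply]; simp

lemma homeo_zpow_apply_neg (T : X ≃ₜ X) (n : ℤ) (x : X) : (T ^ n) ((T ^ (-n)) x) = x := by
  rw [← homeo_zpow_add_apply]; simp

lemma measurePreserving_zpow (hT : MeasurePreserving T μ μ) (n : ℤ) :
    MeasurePreserving (T ^ n : X ≃ₜ X) μ μ := by
  have hpow : ∀ n : ℕ, MeasurePreserving (T ^ n : X ≃ₜ X) μ μ := by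
    intro n
    induction n with
    | zero => rw [pow_zero]; exact MeasurePreserving.id μ
    | succ k ih => rw [pow_succ]; exact ih.comp hT
  obtain ⟨m, rfl | rfl⟩ := n.eq_nat_or_neg
  · simpa using hpow m
  · rw [zpow_neg, zpow_natCast]
    exact MeasurePreserving.symm (T ^ m : X ≃ₜ X).toMeasurableEquiv (hpow m)

lemma ae_forall_zpow (hT : MeasurePreserving T μ μ) {P : X → Prop} (h : ∀ᵐ x ∂μ, P x) :
    ∀ᵐ x ∂μ, ∀ n : ℤ, P ((T ^ n) x) :=
  ae_all_iff.2 fun n => (measurePreserving_zpow hT n).quasiMeasurePreserving.ae h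

/-- `f` is locally constant at almost every point. For a predicate, this says that the set it
defines is, up to a null set, both open and closed, i.e. has a null frontier. -/
def AELocConst (μ : Measure X) (f : X → α) : Prop :=
  ∀ᵐ x ∂μ, ∀ᶠ y in 𝓝 x, f y = f x

/-- Near almost every point, `σ` coincides with some power of `T`. -/
def AELocPow (T : X ≃ₜ X) (μ : Measure X) (σ : X → X) : Prop :=
  ∀ᵐ x ∂μ, ∃ n : ℤ, ∀ᶠ y in 𝓝 x, σ y = (T ^ n) y

namespace AELocConst

lemma const (a : α) : AELocConst μ (fun _ : X => a) := by simp [AELocConst]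

lemma comp {f : X → α} (hf : AELocConst μ f) (g : α → β) : AELocConst μ (fun x => g (f x)) := by
  filter_upwards [hf] with x hx
  filter_upwards [hx] with y hy
  rw [hy]

lemma comp₂ {f : X → α} {f' : X → β} (hf : AELocConst μ f) (hf' : AELocConst μ f')
    (g : α → β → γ) : AELocConst μ (fun x => g (f x) (f' x)) := by
  filter_upwards [hf, hf'] with x hx hx'
  filter_upwards [hx, hx'] with y hy hy'
  rw [hy, hy']

lemma pi {ι : Type*} [Finite ι] {f : ι → X → α} (hf : ∀ i, AELocConst μ (f i)) :
    AELocConst μ (fun x i => f i x) := by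
  filter_upwards [ae_all_iff.2 hf] with x hx
  filter_upwards [eventually_all.2 hx] with y hy
  exact funext hy

lemma and {P Q : X → Prop} (hP : AELocConst μ P) (hQ : AELocConst μ Q) :
    AELocConst μ (fun x => P x ∧ Q x) := hP.comp₂ hQ And

lemma or {P Q : X → Prop} (hP : AELocConst μ P) (hQ : AELocConst μ Q) :
    AELocConst μ (fun x => P x ∨ Q x) := hP.comp₂ hQ Or

lemma not {P : X → Prop} (hP : AELocConst μ P) : AELocConst μ (fun x => ¬ P x) := hP.comp Not

lemma mem_of_null_frontier {U : Set X} (hU : μ (frontier U) = 0) : AELocConst μ (· ∈ U) := by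
  filter_upwards [measure_eq_zero_iff_ae_notMem.1 hU] with x hx
  by_cases h : x ∈ interior U
  · filter_upwards [mem_interior_iff_mem_nhds.1 h] with y hy
    simp [hy, interior_subset h]
  · have h' : x ∉ closure U := fun hc => hx ⟨hc, h⟩
    filter_upwards [isClosed_closure.isOpen_compl.mem_nhds h'] with y hy
    simp only [eq_iff_iff]
    exact ⟨fun hyU => absurd (subset_closure hyU) hy, fun hxU => absurd (subset_closure hxU) h'⟩

lemma nullMeasurableSet {A : Set X} (hA : AELocConst μ (· ∈ A)) : NullMeasurableSet A μ := by
  refine ⟨interior A, isOpen_interior.measurableSet, ?_⟩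
  filter_upwards [hA] with x hx
  refine propext ⟨fun h => ?_, fun h => interior_subset h⟩
  refine mem_interior_iff_mem_nhds.2 ?_
  filter_upwards [hx] with y hy
  exact hy ▸ h

lemma nullMeasurableSet_setOf {P : X → Prop} (hP : AELocConst μ P) :
    NullMeasurableSet {x | P x} μ := nullMeasurableSet (A := {x | P x}) hP

/-- A least index defined by almost everywhere locally constant conditions is almost everywhere
locally constant: only finitely many of the conditions determine it at a given point. -/
lemma sInf {P : ℕ → X → Prop} (hP : ∀ n, AELocConst μ (P n)) (hex : ∀ᵐ x ∂μ, ∃ n, P n x) :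
    AELocConst μ (fun x => sInf {n | P n x}) := by
  filter_upwards [ae_all_iff.2 hP, hex] with x hx hn
  have hmem : P (InfSet.sInf {n | P n x}) x := Nat.sInf_mem (s := {n | P n x}) hn
  have h := (Finset.range (InfSet.sInf {n | P n x} + 1)).eventually_all.2
    (fun n _ => hx n)
  filter_upwards [h] with y hy
  have hy' : ∀ n ≤ InfSet.sInf {n | P n x}, (P n y ↔ P n x) := fun n hn =>
    iff_of_eq (hy n (Finset.mem_range.2 (Nat.lt_succ_of_le hn)))
  apply le_antisymm
  · exact Nat.sInf_le ((hy' _ le_rfl).2 hmem)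
  · by_contra! hlt
    have hmem' : P (InfSet.sInf {n | P n y}) y :=
      Nat.sInf_mem (s := {n | P n y}) ⟨_, (hy' _ le_rfl).2 hmem⟩
    exact absurd (Nat.sInf_le (s := {n | P n x}) ((hy' _ hlt.le).1 hmem')) (not_le.2 hlt)

lemma comp_zpow (hT : MeasurePreserving T μ μ) {f : X → α} (hf : AELocConst μ f) (n : ℤ) :
    AELocConst μ (fun x => f ((T ^ n) x)) := by
  filter_upwards [ae_forall_zpow hT hf] with x hx
  exact (T ^ n : X ≃ₜ X).continuous.continuousAt.eventually (hx n)

lemma comp_locPow (hT : MeasurePreserving T μ μ) {f : X → α} (hf : AELocConst μ f) {σ : X → X}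
    (hσ : AELocPow T μ σ) : AELocConst μ (fun x => f (σ x)) := by
  filter_upwards [ae_forall_zpow hT hf, hσ] with x hx ⟨n, hn⟩
  filter_upwards [(T ^ n : X ≃ₜ X).continuous.continuousAt.eventually (hx n), hn] with y hy hny
  rw [hny, hn.self_of_nhds, hy]

end AELocConst

namespace AELocPow

lemma zpow (n : ℤ) : AELocPow T μ (fun x => (T ^ n) x) := Eventually.of_forall fun _ => ⟨n, by simp⟩

lemma id : AELocPow T μ (fun x => x) := by simpa using zpow (T := T) (μ := μ) 0

lemma comp (hT : MeasurePreserving T μ μ) {σ τ : X → X} (hσ : AELocPow T μ σ)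
    (hτ : AELocPow T μ τ) : AELocPow T μ (fun x => σ (τ x)) := by
  filter_upwards [ae_forall_zpow hT hσ, hτ] with x hx ⟨n, hn⟩
  obtain ⟨m, hm⟩ := hx n
  refine ⟨m + n, ?_⟩
  filter_upwards [(T ^ n : X ≃ₜ X).continuous.continuousAt.eventually hm, hn] with y hy hny
  rw [hny, hy, homeo_zpow_add_apply]

lemma iterate (hT : MeasurePreserving T μ μ) {σ : X → X} (hσ : AELocPow T μ σ) (n : ℕ) :
    AELocPow T μ (σ^[n]) := by
  induction n with
  | zero => exact id
  | succ k ih =>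
    rw [Function.iterate_succ]
    exact comp (σ := σ^[k]) (τ := σ) hT ih hσ

lemma glue {ι : Type*} [Countable ι] {k : X → ι} (hk : AELocConst μ k) {σ : ι → X → X}
    (hσ : ∀ i, AELocPow T μ (σ i)) : AELocPow T μ (fun x => σ (k x) x) := by
  filter_upwards [hk, ae_all_iff.2 hσ] with x hx hx'
  obtain ⟨n, hn⟩ := hx' (k x)
  refine ⟨n, ?_⟩
  filter_upwards [hx, hn] with y hy hny
  rw [hy, hny]

lemma ae_comp (hT : MeasurePreserving T μ μ) {σ : X → X} (hσ : AELocPow T μ σ) {P : X → Prop}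
    (hP : ∀ᵐ x ∂μ, P x) : ∀ᵐ x ∂μ, P (σ x) := by
  filter_upwards [ae_forall_zpow hT hP, hσ] with x hx ⟨n, hn⟩
  rw [hn.self_of_nhds]
  exact hx n

/-- If almost every point is aperiodic, then two maps that are locally powers of `T` and agree at
a point agree, almost surely, near that point. -/
lemma eventually_eq (hap : ∀ᵐ x ∂μ, ∀ n : ℤ, (T ^ n) x = x → n = 0) {σ τ : X → X}
    (hσ : AELocPow T μ σ) (hτ : AELocPow T μ τ) :
    ∀ᵐ x ∂μ, σ x = τ x → ∀ᶠ y in 𝓝 x, σ y = τ y := by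
  filter_upwards [hap, hσ, hτ] with x hx ⟨n, hn⟩ ⟨m, hm⟩ heq
  rw [hn.self_of_nhds, hm.self_of_nhds] at heq
  have : -m + n = 0 := hx _ (by rw [homeo_zpow_add_apply, heq, homeo_zpow_neg_apply])
  obtain rfl : n = m := by omega
  filter_upwards [hn, hm] with y hy hy'
  rw [hy, hy']

/-- A map that is locally a power of `T` and almost surely injective on `A` does not decrease
measure. -/
lemma measure_le (hT : MeasurePreserving T μ μ) {σ τ : X → X} (hσ : AELocPow T μ σ) {A B : Set X}
    (hA : NullMeasurableSet A μ) (h : ∀ᵐ x ∂μ, x ∈ A → σ x ∈ B ∧ τ (σ x) = x) : μ A ≤ μ B := by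
  obtain ⟨e⟩ : Nonempty (ℕ ≃ ℤ) := ⟨(Denumerable.eqv ℤ).symm⟩
  set V : ℕ → Set X := fun i => {x | ∀ᶠ y in 𝓝 x, σ y = (T ^ e i) y}
  have hV : ∀ i, MeasurableSet (V i) := fun i => isOpen_setOfPred_eventually_nhds.measurableSet
  set A' : Set X := {x | x ∈ A ∧ σ x ∈ B ∧ τ (σ x) = x}
  have hA' : A' =ᵐ[μ] A := by
    filter_upwards [h] with x hx
    exact propext ⟨fun h => h.1, fun h => ⟨h, hx h⟩⟩
  have hA'm : NullMeasurableSet A' μ := hA.congr hA'.symm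
  set D : ℕ → Set X := fun i => A' ∩ disjointed V i
  have hDm : ∀ i, NullMeasurableSet (D i) μ := fun i =>
    hA'm.inter (MeasurableSet.disjointed hV i).nullMeasurableSet
  set E : ℕ → Set X := fun i => (T ^ (-e i) : X ≃ₜ X) ⁻¹' D i
  have hEm : ∀ i, NullMeasurableSet (E i) μ := fun i =>
    (hDm i).preimage (measurePreserving_zpow hT _).quasiMeasurePreserving
  have hEval : ∀ i, ∀ y ∈ E i, y ∈ B ∧ τ y ∈ D i := by
    intro i y hy
    have hy' : (T ^ (-e i)) y ∈ D i := hy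
    have h1 : σ ((T ^ (-e i)) y) = y := by
      have := (disjointed_subset V i hy'.2).self_of_nhds
      rw [this, homeo_zpow_apply_neg]
    have h2 := hy'.1.2
    rw [h1] at h2
    exact ⟨h2.1, h2.2 ▸ hy'⟩
  have hEdisj : Pairwise (Function.onFun Disjoint E) := by
    intro i j hij
    refine Set.disjoint_left.2 fun y hi hj => ?_
    exact Set.disjoint_left.1 (disjoint_disjointed V hij) (hEval i y hi).2.2 (hEval j y hj).2.2
  calc μ A = μ A' := (measure_congr hA').symm
    _ ≤ μ (⋃ i, D i) := by
        apply measure_mono_ae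
        filter_upwards [hσ] with x ⟨n, hn⟩ hx
        have : x ∈ ⋃ i, disjointed V i := by
          rw [iUnion_disjointed]
          refine mem_iUnion.2 ⟨e.symm n, ?_⟩
          simpa [V] using hn
        obtain ⟨i, hi⟩ := mem_iUnion.1 this
        exact mem_iUnion.2 ⟨i, hx, hi⟩
    _ ≤ ∑' i, μ (D i) := measure_iUnion_le _
    _ = ∑' i, μ (E i) := by
        congr 1; ext i
        exact ((measurePreserving_zpow hT _).measure_preimage (hDm i)).symm
    _ ≤ μ (⋃ i, E i) := tsum_meas_le_meas_iUnion_of_disjoint₀ μ hEm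
        fun i j hij => (hEdisj hij).aedisjoint
    _ ≤ μ B := measure_mono (iUnion_subset fun i y hy => (hEval i y hy).1)

end AELocPow

/-- Almost every point visits a set of positive measure at a positive time. -/
lemma ae_exists_pow_mem [IsFiniteMeasure μ] (hT : Ergodic T μ) {C : Set X}
    (hC : NullMeasurableSet C μ) (h0 : μ C ≠ 0) : ∀ᵐ x ∂μ, ∃ n : ℕ, 0 < n ∧ (T ^ n) x ∈ C := by
  have hmp := hT.toMeasurePreserving
  set W : Set X := ⋃ n : ℕ, (T ^ (n + 1) : X ≃ₜ X) ⁻¹' C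
  have hmpn : ∀ n : ℕ, MeasurePreserving (T ^ n : X ≃ₜ X) μ μ := fun n => by
    simpa using measurePreserving_zpow hmp n
  have hW : NullMeasurableSet W μ := NullMeasurableSet.iUnion fun n =>
    hC.preimage (hmpn _).quasiMeasurePreserving
  have hsub : T ⁻¹' W ⊆ W := by
    intro x hx
    obtain ⟨n, hn⟩ := mem_iUnion.1 hx
    refine mem_iUnion.2 ⟨n + 1, ?_⟩
    rw [mem_preimage, pow_succ]
    exact hn
  rcases hT.ae_empty_or_univ_of_preimage_ae_le hW (LE.le.eventuallyLE hsub) with h | h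
  · exfalso
    apply h0
    have h1 : μ W = 0 := by simpa using measure_congr h
    have h2 : μ ((T ^ (0 + 1) : X ≃ₜ X) ⁻¹' C) = 0 :=
      measure_mono_null (subset_iUnion (fun n : ℕ => (T ^ (n + 1) : X ≃ₜ X) ⁻¹' C) 0) h1
    rwa [(hmpn (0 + 1)).measure_preimage hC] at h2
  · filter_upwards [h] with x hx
    have hxW : x ∈ W := by
      have : W x := by rw [hx]; trivial
      exact this
    obtain ⟨n, hn⟩ := mem_iUnion.1 hxW
    exact ⟨n + 1, n.succ_pos, hn⟩

lemma ergodic_homeo_symm (hT : Ergodic T μ) : Ergodic (T⁻¹ : X ≃ₜ X) μ :=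
  Ergodic.symm (e := T.toMeasurableEquiv) hT

end Basics

/-! ### Cutting sets into pieces of equal measure -/

section Cutting

variable {X : Type*} [TopologicalSpace X] [PolishSpace X] [MeasurableSpace X] [BorelSpace X]
  {μ : Measure X}

/-- A Polish space with a finite measure has a countable base of open sets with null frontier:
almost all radii give balls with null boundary. -/
lemma exists_base_null_frontier (μ : Measure X) [IsFiniteMeasure μ] :
    ∃ U : ℕ → Set X, (∀ n, IsOpen (U n)) ∧ (∀ n, μ (frontier (U n)) = 0) ∧
      ∀ x, ∀ V ∈ 𝓝 x, ∃ n, x ∈ U n ∧ U n ⊆ V := by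
  let := upgradeIsCompletelyMetrizable X
  rcases isEmpty_or_nonempty X with hX | hX
  · exact ⟨fun _ => ∅, by simp, by simp, fun x => isEmptyElim x⟩
  have hr : ∀ p : ℕ × ℕ, ∃ r ∈ Ioo (1 / (p.2 + 2 : ℝ)) (1 / (p.2 + 1 : ℝ)),
      μ (frontier (Metric.thickening r {denseSeq X p.1})) = 0 := fun p =>
    exists_null_frontier_thickening μ _ (by
      apply one_div_lt_one_div_of_lt <;> [positivity; linarith])
  choose r hr hnull using hr
  refine ⟨fun n => Metric.thickening (r n.unpair) {denseSeq X n.unpair.1},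
    fun n => Metric.isOpen_thickening, fun n => hnull _, fun x V hV => ?_⟩
  obtain ⟨δ, hδ, hball⟩ := Metric.mem_nhds_iff.1 hV
  obtain ⟨m, hm⟩ := exists_nat_one_div_lt (half_pos hδ)
  obtain ⟨j, hj⟩ := (denseRange_denseSeq X).exists_dist_lt x
    (show (0 : ℝ) < 1 / (m + 2) by positivity)
  refine ⟨Nat.pair j m, ?_, ?_⟩
  · simp only [Nat.unpair_pair, Metric.thickening_singleton, Metric.mem_ball]
    exact hj.trans (hr (j, m)).1
  · simp only [Nat.unpair_pair, Metric.thickening_singleton]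
    intro y hy
    apply hball
    have h1 := (hr (j, m)).1
    have h2 := (hr (j, m)).2
    simp only at h1 h2
    have h3 := dist_triangle_right y x (denseSeq X j)
    rw [Metric.mem_ball] at *
    linarith

/-- An injective, almost everywhere continuous function to the reals. Its level sets are null for
a measure without atoms, so that it can be used to cut off sets of prescribed measure. -/
lemma exists_injective_ae_continuousAt (μ : Measure X) [IsFiniteMeasure μ] :
    ∃ f : X → ℝ, Function.Injective f ∧ (∀ᵐ x ∂μ, ContinuousAt f x) ∧
      ∃ R : ℝ, ∀ x, 0 ≤ f x ∧ f x < R := by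
  classical
  obtain ⟨U, hUo, hUf, hU⟩ := exists_base_null_frontier μ
  set b : X → ℕ → Bool := fun x n => decide (x ∈ U n)
  have hb : Function.Injective b := by
    intro x y hxy
    by_contra hne
    obtain ⟨n, hn, hn'⟩ := hU x {y}ᶜ (isOpen_compl_singleton.mem_nhds hne)
    have : decide (x ∈ U n) = decide (y ∈ U n) := congrFun hxy n
    have hy : y ∈ U n := by simpa [hn] using this
    exact hn' hy rfl
  have hc : Continuous (Cardinal.cantorFunction (1 / 3)) := by
    unfold Cardinal.cantorFunction
    refine continuous_tsum (u := fun n => (1 / 3 : ℝ) ^ n) (fun n => ?_)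
      (summable_geometric_of_lt_one (by norm_num) (by norm_num)) fun n f => ?_
    · exact (continuous_of_discreteTopology (f := fun c : Bool => cond c ((1 / 3 : ℝ) ^ n) 0)).comp
        (continuous_apply n)
    · unfold Cardinal.cantorFunctionAux
      cases f n <;> simp
  refine ⟨fun x => Cardinal.cantorFunction (1 / 3) (b x),
    (Cardinal.cantorFunction_injective (by norm_num) (by norm_num)).comp hb, ?_,
    Cardinal.cantorFunction (1 / 3) (fun _ => true) + 1, fun x => ⟨?_, ?_⟩⟩
  · filter_upwards [ae_all_iff.2 fun n => AELocConst.mem_of_null_frontier (hUf n)] with x hx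
    refine hc.continuousAt.comp (continuousAt_pi.2 fun n => ?_)
    refine (continuousAt_const (y := b x n)).congr ?_
    filter_upwards [hx n] with y hy
    simp only [b]
    exact decide_eq_decide.2 (iff_of_eq hy).symm
  · unfold Cardinal.cantorFunction
    refine tsum_nonneg fun n => ?_
    unfold Cardinal.cantorFunctionAux
    cases b x n <;> simp
  · have := Cardinal.cantorFunction_le (c := 1 / 3) (f := b x) (g := fun _ => true)
      (by norm_num) (by norm_num) (by simp)
    linarith

/-- A strict sublevel set of an almost everywhere continuous function has null frontier as soon as
the corresponding level set is null. -/
lemma AELocConst.lt {F : X → ℝ} (hF : ∀ᵐ x ∂μ, ContinuousAt F x)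
    (hlevel : ∀ t, μ {x | F x = t} = 0) (t : ℝ) : AELocConst μ (fun x => F x < t) := by
  filter_upwards [hF, measure_eq_zero_iff_ae_notMem.1 (hlevel t)] with x hx hne
  rcases lt_or_gt_of_ne (show F x ≠ t from hne) with h | h
  · filter_upwards [hx.eventually_lt continuousAt_const h] with y hy
    simp [h, hy]
  · filter_upwards [continuousAt_const.eventually_lt hx h] with y hy
    simp [not_lt.2 h.le, not_lt.2 hy.le]

/-- The distribution function of an almost everywhere continuous function with null level sets
takes every intermediate value. -/
lemma exists_measure_lt_eq [IsFiniteMeasure μ] {F : X → ℝ}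
    (hF : ∀ᵐ x ∂μ, ContinuousAt F x) (hlevel : ∀ t, μ {x | F x = t} = 0) {R : ℝ}
    (hR : ∀ x, 0 ≤ F x ∧ F x < R) (B : Set X) (hB : NullMeasurableSet B μ) {s : ENNReal}
    (hs : s ≤ μ B) : ∃ t, μ (B ∩ {x | F x < t}) = s := by
  have hfull : B ∩ {x | F x < R} = B := by
    ext x; simp [(hR x).2]
  rcases hs.eq_or_lt with rfl | hlt
  · exact ⟨R, by rw [hfull]⟩
  have hmono : ∀ {t t' : ℝ}, t ≤ t' → μ (B ∩ {x | F x < t}) ≤ μ (B ∩ {x | F x < t'}) :=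
    fun h => measure_mono (inter_subset_inter_right _ fun x (hx : F x < _) => lt_of_lt_of_le hx h)
  set S : Set ℝ := {t | μ (B ∩ {x | F x < t}) ≤ s}
  have hS0 : (0 : ℝ) ∈ S := by
    have : B ∩ {x | F x < 0} = ∅ := by
      ext x; simp [(hR x).1]
    simp [S, this]
  have hSb : BddAbove S := by
    refine ⟨R, fun t ht => ?_⟩
    by_contra! hcon
    have := (hmono hcon.le).trans ht
    rw [hfull] at this
    exact absurd this (not_le.2 hlt)
  refine ⟨sSup S, le_antisymm ?_ ?_⟩
  · have hU : B ∩ {x | F x < sSup S} = ⋃ n : ℕ, B ∩ {x | F x < sSup S - 1 / (n + 1 : ℝ)} := by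
      ext x
      simp only [mem_inter_iff, mem_ofPred_eq, mem_iUnion]
      constructor
      · rintro ⟨hx, hlt⟩
        obtain ⟨n, hn⟩ := exists_nat_one_div_lt (sub_pos.2 hlt)
        exact ⟨n, hx, by linarith⟩
      · rintro ⟨n, hx, hlt⟩
        exact ⟨hx, hlt.trans (sub_lt_self _ Nat.one_div_pos_of_nat)⟩
    rw [hU, Monotone.measure_iUnion]
    · refine iSup_le fun n => ?_
      obtain ⟨t, ht, hlt⟩ := exists_lt_of_lt_csSup ⟨0, hS0⟩
        (sub_lt_self (sSup S) (Nat.one_div_pos_of_nat (n := n)))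
      exact (hmono hlt.le).trans ht
    · intro m n hmn
      refine inter_subset_inter_right _ fun x (hx : F x < _) => lt_of_lt_of_le hx ?_
      exact sub_le_sub_left (Nat.one_div_le_one_div hmn) _
  · have hI : B ∩ {x | F x ≤ sSup S} = ⋂ n : ℕ, B ∩ {x | F x < sSup S + 1 / (n + 1 : ℝ)} := by
      ext x
      simp only [mem_inter_iff, mem_ofPred_eq, mem_iInter]
      constructor
      · rintro ⟨hx, hle⟩ n
        exact ⟨hx, hle.trans_lt (lt_add_of_pos_right _ Nat.one_div_pos_of_nat)⟩
      · intro h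
        refine ⟨(h 0).1, ?_⟩
        by_contra! hcon
        obtain ⟨n, hn⟩ := exists_nat_one_div_lt (sub_pos.2 hcon)
        have := (h n).2
        linarith
    have hsub : μ (B ∩ {x | F x ≤ sSup S}) ≤ μ (B ∩ {x | F x < sSup S}) := by
      have : B ∩ {x | F x ≤ sSup S} ⊆ (B ∩ {x | F x < sSup S}) ∪ {x | F x = sSup S} := by
        rintro x ⟨hx, hle⟩
        rcases (show F x ≤ sSup S from hle).lt_or_eq with h | h
        · exact Or.inl ⟨hx, h⟩
        · exact Or.inr h
      refine (measure_mono this).trans ((measure_union_le _ _).trans ?_)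
      rw [hlevel, add_zero]
    refine le_trans ?_ hsub
    rw [hI, Antitone.measure_iInter]
    · refine le_iInf fun n => ?_
      by_contra! hcon
      exact absurd (le_csSup hSb hcon.le)
        (not_le.2 (lt_add_of_pos_right _ (Nat.one_div_pos_of_nat (n := n))))
    · intro m n hmn
      refine inter_subset_inter_right _ fun x (hx : F x < _) => lt_of_lt_of_le hx ?_
      exact add_le_add_right (Nat.one_div_le_one_div hmn) _
    · exact fun n => hB.inter (AELocConst.lt hF hlevel _).nullMeasurableSet_setOf
    · exact ⟨0, measure_ne_top _ _⟩

/-- A set with null frontier can be cut into `M` pieces of equal measure with null frontier, so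
that all but `r` of them are contained in a single atom of a given partition into `r` atoms. -/
lemma exists_equal_cut [IsFiniteMeasure μ] [NullSingletonClass μ] {B : Set X}
    (hB : AELocConst μ (· ∈ B)) {r : ℕ} {Q : X → Fin r} (hQ : AELocConst μ Q) {M : ℕ}
    (hM : 0 < M) :
    ∃ A : Fin M → Set X, (∀ j, AELocConst μ (· ∈ A j)) ∧ Pairwise (Function.onFun Disjoint A) ∧
      (∀ j, A j ⊆ B) ∧ (∀ᵐ x ∂μ, x ∈ B → ∃ j, x ∈ A j) ∧ (∀ j, μ (A j) = μ B / M) ∧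
      ∃ bad : Finset (Fin M), bad.card ≤ r ∧ ∀ j ∉ bad, ∀ x ∈ A j, ∀ y ∈ A j, Q x = Q y := by
  classical
  by_cases h0 : μ B = 0
  · refine ⟨fun _ => ∅, fun _ => AELocConst.const False, fun _ _ _ => by simp [Function.onFun],
      by simp, ?_, by simp [h0], ∅, by simp, by simp⟩
    filter_upwards [measure_eq_zero_iff_ae_notMem.1 h0] with x hx hxB using absurd hxB hx
  obtain ⟨f, hinj, hcont, R, hR⟩ := exists_injective_ae_continuousAt μ
  have hM0 : (M : ENNReal) ≠ 0 := by simpa using hM.ne'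
  -- the atoms of `Q` are stacked on top of each other
  set F : X → ℝ := fun x => R * (Q x : ℕ) + f x
  have hFc : ∀ᵐ x ∂μ, ContinuousAt F x := by
    filter_upwards [hcont, hQ] with x hx hx'
    refine ContinuousAt.add ((continuousAt_const (y := R * (Q x : ℕ))).congr ?_) hx
    filter_upwards [hx'] with y hy
    rw [hy]
  have hFl : ∀ t, μ {x | F x = t} = 0 := by
    intro t
    have : {x | F x = t} ⊆ ⋃ q : Fin r, {x | f x = t - R * (q : ℕ)} := by
      intro x hx
      exact mem_iUnion.2 ⟨Q x, eq_sub_of_add_eq' hx⟩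
    refine measure_mono_null this (measure_iUnion_null fun q => ?_)
    exact Set.Subsingleton.measure_zero
      (fun x hx y hy => hinj (Eq.trans hx (Eq.symm hy))) μ
  have hFR : ∀ x, 0 ≤ F x ∧ F x < R * r := by
    intro x
    have h1 := (hR x).1
    have h2 := (hR x).2
    have hRpos : 0 < R := h1.trans_lt h2
    refine ⟨by positivity, ?_⟩
    have : ((Q x : ℕ) : ℝ) + 1 ≤ r := by exact_mod_cast (Q x).2
    have := mul_le_mul_of_nonneg_left this hRpos.le
    simp only [F]
    linarith
  set β : ENNReal := μ B / M
  have hβ0 : β ≠ 0 := ENNReal.div_ne_zero.2 ⟨h0, by simp⟩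
  have hβt : β ≠ ⊤ := ENNReal.div_ne_top (measure_ne_top _ _) hM0
  have hβM : (M : ENNReal) * β = μ B := ENNReal.mul_div_cancel hM0 (by simp)
  have hex : ∀ j : ℕ, ∃ t, j ≤ M → μ (B ∩ {x | F x < t}) = j * β := by
    intro j
    by_cases hj : j ≤ M
    · obtain ⟨t, ht⟩ := exists_measure_lt_eq hFc hFl hFR B hB.nullMeasurableSet
        (s := j * β) (by rw [← hβM]; gcongr)
      exact ⟨t, fun _ => ht⟩
    · exact ⟨0, fun h => absurd h hj⟩
  choose t ht using hex
  have hmono : ∀ {a b : ℝ}, a ≤ b → B ∩ {x | F x < a} ⊆ B ∩ {x | F x < b} :=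
    fun h => inter_subset_inter_right _ fun x (hx : F x < _) => lt_of_lt_of_le hx h
  have htm : ∀ {i j : ℕ}, i < j → j ≤ M → t i < t j := by
    intro i j hij hj
    by_contra! hcon
    have := measure_mono (μ := μ) (hmono hcon)
    rw [ht j hj, ht i (hij.le.trans hj)] at this
    exact absurd this (not_le.2 ((ENNReal.mul_lt_mul_iff_left hβ0 hβt).2 (by exact_mod_cast hij)))
  have htm' : ∀ {i j : ℕ}, i ≤ j → j ≤ M → t i ≤ t j := by
    intro i j hij hj
    rcases hij.eq_or_lt with rfl | h
    · rfl
    · exact (htm h hj).le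
  have hset : ∀ a, AELocConst μ (· ∈ B ∩ {x | F x < a}) := fun a =>
    hB.and (AELocConst.lt hFc hFl a)
  set A : Fin M → Set X := fun j => (B ∩ {x | F x < t (j + 1)}) \ (B ∩ {x | F x < t j})
  have hA : ∀ j x, x ∈ A j ↔ x ∈ B ∧ t j ≤ F x ∧ F x < t (j + 1) := by
    intro j x
    simp only [A, Set.mem_sdiff, mem_inter_iff, mem_ofPred_eq, not_and, not_lt]
    tauto
  have hsep : ∀ {i j : Fin M} {z : ℝ}, t i ≤ z → z < t (i + 1) → t j ≤ z → z < t (j + 1) →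
      i = j := by
    intro i j z h1 h2 h3 h4
    by_contra hne
    rcases lt_or_gt_of_ne (fun h => hne (Fin.ext h) : (i : ℕ) ≠ j) with h | h
    · exact absurd (h2.trans_le (htm' (Nat.succ_le_of_lt h) j.2.le)) (not_lt.2 h3)
    · exact absurd (h4.trans_le (htm' (Nat.succ_le_of_lt h) i.2.le)) (not_lt.2 h1)
  refine ⟨A, fun j => (hset _).and (hset _).not, ?_, fun j x hx => ((hA j x).1 hx).1, ?_, ?_, ?_⟩
  · intro i j hij
    refine Set.disjoint_left.2 fun x hi hj => hij ?_
    rw [hA] at hi hj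
    exact hsep hi.2.1 hi.2.2 hj.2.1 hj.2.2
  · have h1 : μ (B ∩ {x | F x < t 0}) = 0 := by simpa using ht 0 M.zero_le
    have h2 : μ (B \ (B ∩ {x | F x < t M})) = 0 := by
      rw [measure_sdiff inter_subset_left (hset _).nullMeasurableSet (measure_ne_top _ _),
        ht M le_rfl, hβM, tsub_self]
    filter_upwards [measure_eq_zero_iff_ae_notMem.1 h1, measure_eq_zero_iff_ae_notMem.1 h2]
      with x hx1 hx2 hxB
    have hx1' : ¬ F x < t 0 := fun h => hx1 ⟨hxB, h⟩
    have hx2' : F x < t M := by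
      by_contra h
      exact hx2 ⟨hxB, fun h' => h h'.2⟩
    have hfind : ∃ j, F x < t j := ⟨M, hx2'⟩
    obtain ⟨k, hk⟩ := Nat.exists_eq_succ_of_ne_zero (n := Nat.find hfind) (fun h => hx1' (by
      have := Nat.find_spec hfind
      rwa [h] at this))
    have hkM : k < M := by
      have := Nat.find_min' hfind hx2'
      omega
    refine ⟨⟨k, hkM⟩, (hA _ _).2 ⟨hxB, not_lt.1 (Nat.find_min hfind (by simp [hk])), ?_⟩⟩
    have := Nat.find_spec hfind
    rwa [hk] at this
  · intro j
    rw [measure_sdiff (hmono (htm' (Nat.le_succ _) j.2)) (hset _).nullMeasurableSet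
      (measure_ne_top _ _), ht _ j.2, ht _ j.2.le]
    push_cast
    rw [add_mul, one_mul]
    exact ENNReal.add_sub_cancel_left (ENNReal.mul_ne_top (by simp) hβt)
  · refine ⟨Finset.univ.filter fun j => ∃ x ∈ A j, ∃ y ∈ A j, Q x < Q y, ?_, ?_⟩
    · -- a piece which meets two atoms is cut by the level separating them
      have hw : ∀ j : Fin M, ∃ l : Fin r, (∃ x ∈ A j, ∃ y ∈ A j, Q x < Q y) →
          t j ≤ R * (l : ℕ) ∧ R * (l : ℕ) < t (j + 1) := by
        intro j
        by_cases hj : ∃ x ∈ A j, ∃ y ∈ A j, Q x < Q y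
        · obtain ⟨x, hx, y, hy, hxy⟩ := hj
          refine ⟨Q y, fun _ => ⟨?_, ?_⟩⟩
          · have h1 := ((hA _ _).1 hx).2.1
            have h2 := (hR x).2
            have hRpos : 0 < R := (hR x).1.trans_lt h2
            have h3 : ((Q x : ℕ) : ℝ) + 1 ≤ (Q y : ℕ) := by exact_mod_cast hxy
            have h4 := mul_le_mul_of_nonneg_left h3 hRpos.le
            simp only [F] at h1
            linarith
          · have h1 := ((hA _ _).1 hy).2.2
            have h2 := (hR y).1
            simp only [F] at h1
            linarith
        · obtain ⟨x⟩ : Nonempty X := nonempty_of_measure_ne_zero h0 |>.to_type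
          exact ⟨Q x, fun h => absurd h hj⟩
      choose l hl using hw
      have := Finset.card_le_card_of_injOn (t := (Finset.univ : Finset (Fin r))) l
        (s := Finset.univ.filter fun j => ∃ x ∈ A j, ∃ y ∈ A j, Q x < Q y)
        (fun _ _ => Finset.mem_coe.2 (Finset.mem_univ _)) (by
          intro i hi j hj hij
          have hi' := hl i (by simpa using hi)
          have hj' := hl j (by simpa using hj)
          rw [hij] at hi'
          exact hsep hi'.1 hi'.2 hj'.1 hj'.2)
      simpa using this
    · intro j hj x hx y hy
      simp only [Finset.mem_filter, Finset.mem_univ, true_and, not_exists, not_and, not_lt] at hj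
      exact le_antisymm (hj y hy x hx) (hj x hx y hy)

/-- A set with null frontier contains sets with null frontier and arbitrarily small positive
measure. -/
lemma exists_small_subset [IsFiniteMeasure μ] [NullSingletonClass μ] {B : Set X}
    (hB : AELocConst μ (· ∈ B)) (h0 : μ B ≠ 0) {ε : ENNReal} (hε : ε ≠ 0) :
    ∃ C ⊆ B, AELocConst μ (· ∈ C) ∧ μ C ≠ 0 ∧ μ C < ε := by
  obtain ⟨n, hn⟩ := ENNReal.exists_inv_nat_lt (ENNReal.div_ne_zero.2 ⟨hε, measure_ne_top μ B⟩)
  obtain ⟨A, hA, -, hAB, -, hAm, -⟩ := exists_equal_cut (r := 1) (Q := fun _ => 0) hB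
    (AELocConst.const _) n.succ_pos
  refine ⟨A 0, hAB 0, hA 0, ?_, ?_⟩
  · rw [hAm]
    exact ENNReal.div_ne_zero.2 ⟨h0, by simp⟩
  · rw [hAm]
    calc μ B / ((n + 1 : ℕ) : ENNReal) ≤ μ B * (n : ENNReal)⁻¹ := by
          rw [div_eq_mul_inv]; gcongr; exact n.le_succ
      _ < μ B * (ε / μ B) := by
          exact (ENNReal.mul_lt_mul_iff_right h0 (measure_ne_top _ _)).2 hn
      _ = ε := ENNReal.mul_div_cancel h0 (measure_ne_top _ _)

/-- Almost every point of an ergodic homeomorphism is aperiodic when there are no atoms: if almost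
all points had period `n`, `n` preimages of a set of measure less than `1 / n` could not
cover the space, contrary to ergodicity. -/
lemma ae_aperiodic [IsProbabilityMeasure μ] [NullSingletonClass μ] {T : X ≃ₜ X}
    (hT : Ergodic T μ) : ∀ᵐ x ∂μ, ∀ n : ℤ, (T ^ n) x = x → n = 0 := by
  have hmp := hT.toMeasurePreserving
  have hpos : ∀ n : ℕ, ∀ᵐ x ∂μ, (T ^ (n + 1)) x ≠ x := by
    intro n
    set Z : Set X := {x | (T ^ (n + 1)) x = x}
    have hZ : MeasurableSet Z :=
      (isClosed_eq (T ^ (n + 1) : X ≃ₜ X).continuous continuous_id).measurableSet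
    have hinv : T ⁻¹' Z = Z := by
      ext x
      change (T ^ (n + 1)) (T x) = T x ↔ (T ^ (n + 1)) x = x
      have : (T ^ (n + 1)) (T x) = T ((T ^ (n + 1)) x) := by
        have h := congrArg (fun S : X ≃ₜ X => S x) (pow_mul_comm' T (n + 1))
        exact h
      rw [this, T.injective.eq_iff]
    rcases hT.toPreErgodic.ae_mem_or_ae_notMem hZ hinv with h | h
    · exfalso
      obtain ⟨C, -, hC, hC0, hCε⟩ := exists_small_subset (μ := μ) (B := univ)
        (AELocConst.const True) (by simp) (ε := ((n + 1 : ℕ) : ENNReal)⁻¹) (by simp)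
      have hcov : μ univ ≤ μ (⋃ i : Fin (n + 1), (T ^ (i : ℤ) : X ≃ₜ X) ⁻¹' C) := by
        apply measure_mono_ae
        filter_upwards [h, ae_exists_pow_mem hT hC.nullMeasurableSet hC0] with x hx ⟨k, _, hk⟩ _
        refine mem_iUnion.2 ⟨⟨k % (n + 1), Nat.mod_lt _ n.succ_pos⟩, ?_⟩
        have hper : ∀ q : ℕ, (T ^ ((n + 1) * q)) x = x := by
          intro q
          induction q with
          | zero => rfl
          | succ q ih =>
            rw [Nat.mul_succ, pow_add]
            exact (congrArg (T ^ ((n + 1) * q)) hx).trans ih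
        rw [mem_preimage, zpow_natCast]
        have : (T ^ k) x = (T ^ (k % (n + 1))) x := by
          conv_lhs => rw [← Nat.mod_add_div k (n + 1), pow_add]
          change (T ^ (k % (n + 1))) ((T ^ ((n + 1) * (k / (n + 1)))) x) = _
          rw [hper]
        exact this ▸ hk
      have hlt : μ (⋃ i : Fin (n + 1), (T ^ (i : ℤ) : X ≃ₜ X) ⁻¹' C) < 1 := by
        calc _ ≤ ∑ i : Fin (n + 1), μ ((T ^ (i : ℤ) : X ≃ₜ X) ⁻¹' C) :=
              measure_iUnion_fintype_le _ _
          _ = ((n + 1 : ℕ) : ENNReal) * μ C := by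
            simp_rw [(measurePreserving_zpow hmp _).measure_preimage hC.nullMeasurableSet]
            simp
          _ < ((n + 1 : ℕ) : ENNReal) * ((n + 1 : ℕ) : ENNReal)⁻¹ :=
            (ENNReal.mul_lt_mul_iff_right (by simp) (by simp)).2 hCε
          _ = 1 := ENNReal.mul_inv_cancel (by simp) (by simp)
      exact absurd hcov (not_le.2 (by simpa using hlt))
    · exact h
  filter_upwards [ae_all_iff.2 hpos] with x hx n hn
  by_contra hne
  obtain ⟨m, rfl | rfl⟩ := n.eq_nat_or_neg
  · obtain ⟨k, rfl⟩ := Nat.exists_eq_succ_of_ne_zero (n := m) (by simpa using hne)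
    rw [zpow_natCast] at hn
    exact hx k hn
  · obtain ⟨k, rfl⟩ := Nat.exists_eq_succ_of_ne_zero (n := m) (by simpa using hne)
    apply hx k
    have := homeo_zpow_apply_neg T (k.succ : ℤ) x
    rw [hn, zpow_natCast] at this
    exact this

end Cutting

/-! ### Partial isomorphisms between sets of equal measure -/

section PartialIso

variable {X : Type*} [TopologicalSpace X] [PolishSpace X] [MeasurableSpace X] [BorelSpace X]
  {μ : Measure X} {T : X ≃ₜ X}

/-- A partial isomorphism from `A` to `B` in the full groupoid of `T`: up to null sets, a bijection
which is locally a power of `T`. The two maps are total functions, but their values outside `A` and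
`B` are irrelevant. -/
structure PartialIso (T : X ≃ₜ X) (μ : Measure X) (A B : Set X) where
  toFun : X → X
  invFun : X → X
  locPow_toFun : AELocPow T μ toFun
  locPow_invFun : AELocPow T μ invFun
  toFun_mem : ∀ᵐ x ∂μ, x ∈ A → toFun x ∈ B
  invFun_mem : ∀ᵐ y ∂μ, y ∈ B → invFun y ∈ A
  left_inv : ∀ᵐ x ∂μ, x ∈ A → invFun (toFun x) = x
  right_inv : ∀ᵐ y ∂μ, y ∈ B → toFun (invFun y) = y

namespace PartialIso

variable {A B C A' B' : Set X}

def refl (A : Set X) : PartialIso T μ A A where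
  toFun x := x
  invFun x := x
  locPow_toFun := .id
  locPow_invFun := .id
  toFun_mem := by simp
  invFun_mem := by simp
  left_inv := by simp
  right_inv := by simp

def trans (hT : MeasurePreserving T μ μ) (θ : PartialIso T μ A B) (η : PartialIso T μ B C) :
    PartialIso T μ A C where
  toFun x := η.toFun (θ.toFun x)
  invFun x := θ.invFun (η.invFun x)
  locPow_toFun := .comp hT η.locPow_toFun θ.locPow_toFun
  locPow_invFun := .comp hT θ.locPow_invFun η.locPow_invFun
  toFun_mem := by
    filter_upwards [θ.toFun_mem, θ.locPow_toFun.ae_comp hT η.toFun_mem] with x h1 h2 hx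
    exact h2 (h1 hx)
  invFun_mem := by
    filter_upwards [η.invFun_mem, η.locPow_invFun.ae_comp hT θ.invFun_mem] with x h1 h2 hx
    exact h2 (h1 hx)
  left_inv := by
    filter_upwards [θ.toFun_mem, θ.left_inv, θ.locPow_toFun.ae_comp hT η.left_inv]
      with x h1 h2 h3 hx
    rw [h3 (h1 hx), h2 hx]
  right_inv := by
    filter_upwards [η.invFun_mem, η.right_inv, η.locPow_invFun.ae_comp hT θ.right_inv]
      with x h1 h2 h3 hx
    rw [h3 (h1 hx), h2 hx]

open Classical in
/-- The union of two partial isomorphisms with disjoint sources and disjoint targets. -/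
noncomputable def union (hA : AELocConst μ (· ∈ A)) (hB : AELocConst μ (· ∈ B))
    (hAA' : Disjoint A A') (hBB' : Disjoint B B') (θ : PartialIso T μ A B) (η : PartialIso T μ A' B') :
    PartialIso T μ (A ∪ A') (B ∪ B') where
  toFun x := (if x ∈ A then θ.toFun else η.toFun) x
  invFun y := (if y ∈ B then θ.invFun else η.invFun) y
  locPow_toFun := by
    refine AELocPow.glue (k := (· ∈ A)) hA (σ := fun p => if p then θ.toFun else η.toFun) ?_
    intro p
    split_ifs
    exacts [θ.locPow_toFun, η.locPow_toFun]
  locPow_invFun := by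
    refine AELocPow.glue (k := (· ∈ B)) hB (σ := fun p => if p then θ.invFun else η.invFun) ?_
    intro p
    split_ifs
    exacts [θ.locPow_invFun, η.locPow_invFun]
  toFun_mem := by
    filter_upwards [θ.toFun_mem, η.toFun_mem] with x h1 h2 hx
    by_cases hxA : x ∈ A
    · simp [hxA, h1 hxA]
    · simp [hxA, h2 (hx.resolve_left hxA)]
  invFun_mem := by
    filter_upwards [θ.invFun_mem, η.invFun_mem] with x h1 h2 hx
    by_cases hxA : x ∈ B
    · simp [hxA, h1 hxA]
    · simp [hxA, h2 (hx.resolve_left hxA)]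
  left_inv := by
    filter_upwards [θ.toFun_mem, η.toFun_mem, θ.left_inv, η.left_inv] with x h1 h2 h3 h4 hx
    by_cases hxA : x ∈ A
    · simp [hxA, h1 hxA, h3 hxA]
    · have hx' := hx.resolve_left hxA
      simp [hxA, disjoint_right.1 hBB' (h2 hx'), h4 hx']
  right_inv := by
    filter_upwards [θ.invFun_mem, η.invFun_mem, θ.right_inv, η.right_inv] with x h1 h2 h3 h4 hx
    by_cases hxA : x ∈ B
    · simp [hxA, h1 hxA, h3 hxA]
    · have hx' := hx.resolve_left hxA
      simp [hxA, disjoint_right.1 hAA' (h2 hx'), h4 hx']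

end PartialIso

/-- Greedy matching of `A` with `B`: in step `n` all remaining points of `A` which `T ^ e n` maps to
remaining points of `B` are removed from `A`, and their images are removed from `B`. The value is
the pair of remaining sets. -/
def greedyRest (T : X ≃ₜ X) (e : ℕ → ℤ) (A B : Set X) : ℕ → Set X × Set X
  | 0 => (A, B)
  | n + 1 =>
    ((greedyRest T e A B n).1 \ (T ^ e n : X ≃ₜ X) ⁻¹' (greedyRest T e A B n).2,
      (greedyRest T e A B n).2 \ (T ^ (-e n) : X ≃ₜ X) ⁻¹' (greedyRest T e A B n).1)

lemma greedyRest_swap (e : ℕ → ℤ) (A B : Set X) (n : ℕ) :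
    greedyRest T (fun n => -e n) B A n = (greedyRest T e A B n).swap := by
  induction n with
  | zero => rfl
  | succ n ih => simp [greedyRest, ih, Prod.swap]

lemma greedyRest_antitone (e : ℕ → ℤ) (A B : Set X) :
    Antitone (fun n => (greedyRest T e A B n).1) :=
  antitone_nat_of_succ_le fun _ => sdiff_subset

lemma greedyRest_locConst (hT : MeasurePreserving T μ μ) (e : ℕ → ℤ) {A B : Set X}
    (hA : AELocConst μ (· ∈ A)) (hB : AELocConst μ (· ∈ B)) (n : ℕ) :
    AELocConst μ (· ∈ (greedyRest T e A B n).1) ∧ AELocConst μ (· ∈ (greedyRest T e A B n).2) := by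
  induction n with
  | zero => exact ⟨hA, hB⟩
  | succ n ih =>
    exact ⟨ih.1.and (ih.2.comp_zpow hT _).not, ih.2.and (ih.1.comp_zpow hT _).not⟩

lemma greedyRest_measure [IsFiniteMeasure μ] (hT : MeasurePreserving T μ μ) (e : ℕ → ℤ)
    {A B : Set X} (hA : AELocConst μ (· ∈ A)) (hB : AELocConst μ (· ∈ B)) (hAB : μ A = μ B)
    (n : ℕ) : μ (greedyRest T e A B n).1 = μ (greedyRest T e A B n).2 := by
  induction n with
  | zero => exact hAB
  | succ n ih =>
    obtain ⟨h1, h2⟩ := greedyRest_locConst hT e hA hB n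
    simp only [greedyRest]
    have h1' := (measurePreserving_zpow hT (-e n)).quasiMeasurePreserving
    have h2' := (measurePreserving_zpow hT (e n)).quasiMeasurePreserving
    rw [← sdiff_self_inter, ← sdiff_self_inter (t := _ ⁻¹' (greedyRest T e A B n).1),
      measure_sdiff inter_subset_left, measure_sdiff inter_subset_left, ih]
    · congr 1
      have h3 : NullMeasurableSet ((greedyRest T e A B n).2 ∩
          (T ^ (-e n) : X ≃ₜ X) ⁻¹' (greedyRest T e A B n).1) μ :=
        h2.nullMeasurableSet.inter (h1.nullMeasurableSet.preimage h1')
      rw [← (measurePreserving_zpow hT (e n)).measure_preimage h3]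
      congr 1
      ext x
      simp only [mem_inter_iff, mem_preimage, homeo_zpow_neg_apply]
      tauto
    · exact h2.nullMeasurableSet.inter (h1.nullMeasurableSet.preimage h1')
    · exact measure_ne_top _ _
    · exact h1.nullMeasurableSet.inter (h2.nullMeasurableSet.preimage h2')
    · exact measure_ne_top _ _

/-- The step in which the greedy procedure moves a point of `A`; zero outside `A`. -/
noncomputable def greedyTime (T : X ≃ₜ X) (e : ℕ → ℤ) (A B : Set X) (x : X) : ℕ :=
  sInf {n | (x ∈ (greedyRest T e A B n).1 ∧ (T ^ e n) x ∈ (greedyRest T e A B n).2) ∨ x ∉ A}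

/-- If the greedy procedure exhausts `A`, it defines an injection of `A` into `B` whose inverse is
given by the same procedure with the roles of `A` and `B` exchanged. -/
lemma greedy_half (hT : MeasurePreserving T μ μ) (e : ℕ → ℤ) {A B : Set X}
    (hA : AELocConst μ (· ∈ A)) (hB : AELocConst μ (· ∈ B))
    (hex : ∀ᵐ x ∂μ, x ∈ A →
      ∃ n, x ∈ (greedyRest T e A B n).1 ∧ (T ^ e n) x ∈ (greedyRest T e A B n).2) :
    AELocPow T μ (fun x => (T ^ e (greedyTime T e A B x)) x) ∧
    ∀ᵐ x ∂μ, x ∈ A → (T ^ e (greedyTime T e A B x)) x ∈ B ∧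
      (T ^ (-e (greedyTime T (fun n => -e n) B A ((T ^ e (greedyTime T e A B x)) x))))
        ((T ^ e (greedyTime T e A B x)) x) = x := by
  constructor
  · refine AELocPow.glue (k := greedyTime T e A B) (σ := fun n x => (T ^ e n) x) ?_
      fun n => AELocPow.zpow _
    refine AELocConst.sInf (fun n => ?_) ?_
    · have := greedyRest_locConst hT e hA hB n
      exact (this.1.and (this.2.comp_zpow hT _)).or hA.not
    · filter_upwards [hex] with x hx
      by_cases hxA : x ∈ A
      · obtain ⟨n, hn⟩ := hx hxA
        exact ⟨n, Or.inl hn⟩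
      · exact ⟨0, Or.inr hxA⟩
  · filter_upwards [hex] with x hx hxA
    obtain ⟨m, hm⟩ := hx hxA
    have hmem : greedyTime T e A B x ∈ {n | (x ∈ (greedyRest T e A B n).1 ∧
        (T ^ e n) x ∈ (greedyRest T e A B n).2) ∨ x ∉ A} := Nat.sInf_mem ⟨m, Or.inl hm⟩
    set n := greedyTime T e A B x
    have hn : x ∈ (greedyRest T e A B n).1 ∧ (T ^ e n) x ∈ (greedyRest T e A B n).2 :=
      hmem.resolve_right (not_not.2 hxA)
    have hanti : Antitone (fun n => (greedyRest T e A B n).2) := by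
      have := greedyRest_antitone (T := T) (fun n => -e n) B A
      simpa only [greedyRest_swap, Prod.fst_swap] using this
    have hyB : (T ^ e n) x ∈ B := hanti n.zero_le hn.2
    refine ⟨hyB, ?_⟩
    have htime : greedyTime T (fun n => -e n) B A ((T ^ e n) x) = n := by
      unfold greedyTime
      simp only [greedyRest_swap, Prod.fst_swap, Prod.snd_swap]
      apply le_antisymm
      · refine Nat.sInf_le (Or.inl ⟨hn.2, ?_⟩)
        rw [homeo_zpow_neg_apply]
        exact hn.1
      · refine le_csInf ⟨n, Or.inl ⟨hn.2, by rw [homeo_zpow_neg_apply]; exact hn.1⟩⟩ ?_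
        rintro k (hk | hk)
        · by_contra! hlt
          have h := hanti (Nat.succ_le_of_lt hlt) hn.2
          exact h.2 hk.2
        · exact absurd hyB hk
    rw [htime, homeo_zpow_neg_apply]

/-- Ergodicity makes the greedy procedure exhaust two sets of equal measure: two remaining sets of
positive measure would be connected by some power of `T`. -/
lemma exists_partialIso [IsProbabilityMeasure μ] (hT : Ergodic T μ) {A B : Set X}
    (hA : AELocConst μ (· ∈ A)) (hB : AELocConst μ (· ∈ B)) (hAB : μ A = μ B) :
    Nonempty (PartialIso T μ A B) := by
  have hmp := hT.toMeasurePreserving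
  obtain ⟨e⟩ : Nonempty (ℕ ≃ ℤ) := ⟨(Denumerable.eqv ℤ).symm⟩
  set PA : ℕ → Set X := fun n => (greedyRest T e A B n).1
  set PB : ℕ → Set X := fun n => (greedyRest T e A B n).2
  have hPA : ∀ n, NullMeasurableSet (PA n) μ := fun n =>
    (greedyRest_locConst hmp e hA hB n).1.nullMeasurableSet
  have hPB : ∀ n, NullMeasurableSet (PB n) μ := fun n =>
    (greedyRest_locConst hmp e hA hB n).2.nullMeasurableSet
  have hantiA : Antitone PA := greedyRest_antitone (T := T) e A B
  have hantiB : Antitone PB := by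
    have := greedyRest_antitone (T := T) (fun n => -e n) B A
    simpa only [greedyRest_swap, Prod.fst_swap] using this
  have hmeas : μ (⋂ n, PA n) = μ (⋂ n, PB n) := by
    rw [hantiA.measure_iInter hPA ⟨0, measure_ne_top _ _⟩,
      hantiB.measure_iInter hPB ⟨0, measure_ne_top _ _⟩]
    exact iInf_congr fun n => greedyRest_measure hmp e hA hB hAB n
  have hnoconn : ∀ x ∈ ⋂ n, PA n, ∀ m : ℤ, (T ^ m) x ∉ ⋂ n, PB n := by
    intro x hx m hm
    have h1 := mem_iInter.1 hx (e.symm m + 1)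
    have h2 := mem_iInter.1 hm (e.symm m)
    refine h1.2 ?_
    simpa using h2
  have hA0 : μ (⋂ n, PA n) = 0 := by
    by_contra hne
    have hB0 : μ (⋂ n, PB n) ≠ 0 := hmeas ▸ hne
    have hvis := ae_exists_pow_mem hT (NullMeasurableSet.iInter hPB) hB0
    refine hne (measure_mono_null (t := {x | ¬ ∃ n : ℕ, 0 < n ∧ (T ^ n) x ∈ ⋂ n, PB n}) ?_ hvis)
    rintro x hx ⟨n, -, hn⟩
    exact hnoconn x hx n (by rwa [zpow_natCast])
  have hB0 : μ (⋂ n, PB n) = 0 := hmeas ▸ hA0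
  have hstep : ∀ x, x ∈ A → x ∉ ⋂ n, PA n → ∃ n, x ∈ PA n ∧ (T ^ e n) x ∈ PB n := by
    intro x hx hx'
    by_contra! hcon
    refine hx' (mem_iInter.2 fun n => ?_)
    induction n with
    | zero => exact hx
    | succ n ih => exact ⟨ih, hcon n ih⟩
  have hstep' : ∀ x, x ∈ B → x ∉ ⋂ n, PB n → ∃ n, x ∈ PB n ∧ (T ^ (-e n)) x ∈ PA n := by
    intro x hx hx'
    by_contra! hcon
    refine hx' (mem_iInter.2 fun n => ?_)
    induction n with
    | zero => exact hx
    | succ n ih => exact ⟨ih, hcon n ih⟩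
  obtain ⟨h1, h2⟩ := greedy_half hmp e hA hB (by
    filter_upwards [measure_eq_zero_iff_ae_notMem.1 hA0] with x hx hxA using hstep x hxA hx)
  obtain ⟨h3, h4⟩ := greedy_half hmp (fun n => -e n) hB hA (by
    filter_upwards [measure_eq_zero_iff_ae_notMem.1 hB0] with x hx hxB
    simpa only [greedyRest_swap, Prod.fst_swap, Prod.snd_swap] using hstep' x hxB hx)
  simp only [neg_neg] at h4
  exact ⟨{
    toFun := _
    invFun := _
    locPow_toFun := h1
    locPow_invFun := h3
    toFun_mem := by filter_upwards [h2] with x hx hxA using (hx hxA).1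
    invFun_mem := by filter_upwards [h4] with x hx hxA using (hx hxA).1
    left_inv := by filter_upwards [h2] with x hx hxA using (hx hxA).2
    right_inv := by filter_upwards [h4] with x hx hxA using (hx hxA).2 }⟩

end PartialIso

/-! ### Finite subrelations of the orbit relation -/

section OrbitSystem

variable {X : Type*} [TopologicalSpace X] [PolishSpace X] [MeasurableSpace X] [BorelSpace X]
  {μ : Measure X} {T : X ≃ₜ X}

/-- The identities at a point `x` which say that `move j x`, for `j : J`, enumerates the class of
`x` in a finite equivalence relation, `idx` being the position of a point in its class. -/
structure OrbitIdentities {J : Type} (D : Set X) (idx : X → J) (move : J → X → X) (x : X) :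
    Prop where
  move_mem : ∀ j, move j x ∈ D
  idx_move : ∀ j, idx (move j x) = j
  move_move : ∀ i j, move i (move j x) = move i x
  move_idx : move (idx x) x = x

/-- A finite subrelation of the orbit relation of `T` on `D`, all of whose classes are enumerated by
`J`: the sets `{idx = j}` partition `D`, and `move j` sends a point to the member of its class which
lies in `{idx = j}`. All of this is up to null sets; the data are locally constant, respectively
locally a power of `T`, at almost every point. -/
structure OrbitSystem (T : X ≃ₜ X) (μ : Measure X) (D : Set X) (J : Type) where
  idx : X → J
  move : J → X → X
  locConst_idx : AELocConst μ idx
  locPow_move : ∀ j, AELocPow T μ (move j)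
  identities : ∀ᵐ x ∂μ, x ∈ D → OrbitIdentities D idx move x

namespace OrbitSystem

variable {D : Set X} {J J' I : Type}

/-- The trivial relation, with one-point classes. -/
def trivialSystem (T : X ≃ₜ X) (μ : Measure X) (J : Type) [Unique J] :
    OrbitSystem T μ univ J where
  idx _ := default
  move _ x := x
  locConst_idx := .const _
  locPow_move _ := .id
  identities := Eventually.of_forall fun x _ =>
    ⟨by simp, fun j => Subsingleton.elim _ _, by simp, rfl⟩

def reindex (S : OrbitSystem T μ D J) (e : J ≃ J') : OrbitSystem T μ D J' where
  idx x := e (S.idx x)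
  move j := S.move (e.symm j)
  locConst_idx := S.locConst_idx.comp e
  locPow_move j := S.locPow_move _
  identities := by
    filter_upwards [S.identities] with x hx hxD
    have h := hx hxD
    exact ⟨fun j => h.move_mem _, fun j => by rw [h.idx_move, e.apply_symm_apply],
      fun i j => h.move_move _ _, by rw [e.symm_apply_apply, h.move_idx]⟩

lemma ae_identities_univ (S : OrbitSystem T μ univ J) :
    ∀ᵐ x ∂μ, OrbitIdentities univ S.idx S.move x := by
  filter_upwards [S.identities] with x hx using hx (mem_univ x)

lemma measure_idx_le (hT : MeasurePreserving T μ μ) (S : OrbitSystem T μ D J)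
    (hD : NullMeasurableSet D μ) (i j : J) :
    μ (D ∩ {x | S.idx x = i}) ≤ μ (D ∩ {x | S.idx x = j}) := by
  refine (S.locPow_move j).measure_le hT (τ := S.move i)
    (hD.inter (S.locConst_idx.comp (· = i)).nullMeasurableSet_setOf) ?_
  filter_upwards [S.identities] with x hx hxi
  have h := hx hxi.1
  refine ⟨⟨h.move_mem j, h.idx_move j⟩, ?_⟩
  rw [h.move_move, ← (show S.idx x = i from hxi.2), h.move_idx]

lemma measure_idx_mem [Fintype J] [IsFiniteMeasure μ] (hT : MeasurePreserving T μ μ)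
    (S : OrbitSystem T μ D J) (hD : NullMeasurableSet D μ) [Nonempty J] (F : Finset J) :
    μ (D ∩ {x | S.idx x ∈ F}) = F.card * (μ D / Fintype.card J) := by
  classical
  have hsum : ∀ (F : Finset J) (j : J), μ (D ∩ {x | S.idx x ∈ F}) =
      F.card * μ (D ∩ {x | S.idx x = j}) := by
    intro F j
    have : D ∩ {x | S.idx x ∈ F} = ⋃ i ∈ F, D ∩ {x | S.idx x = i} := by
      ext x; simp
    rw [this, measure_biUnion_finset₀]
    · rw [Finset.sum_congr rfl fun i _ => le_antisymm (S.measure_idx_le hT hD i j)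
        (S.measure_idx_le hT hD j i)]
      simp
    · intro i _ i' _ hii'
      refine Disjoint.aedisjoint (Set.disjoint_left.2 fun x hx hx' => hii' ?_)
      exact (show S.idx x = i from hx.2).symm.trans hx'.2
    · exact fun i _ => hD.inter (S.locConst_idx.comp (· = i)).nullMeasurableSet_setOf
  obtain ⟨j⟩ := ‹Nonempty J›
  have hall := hsum Finset.univ j
  simp only [Finset.mem_univ, ofPred_true, inter_univ, Finset.card_univ] at hall
  rw [hsum F j, hall, mul_comm (Fintype.card J : ENNReal), ENNReal.mul_div_cancel_right]
  · exact_mod_cast Fintype.card_pos_iff.2 ⟨j⟩ |>.ne'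
  · simp

open Classical in
/-- A partition of `D` into finitely many sets together with partial isomorphisms of one of them
onto all the others. -/
noncomputable def ofPartition [Finite J] (hT : MeasurePreserving T μ μ) {B : J → Set X}
    (hB : ∀ j, AELocConst μ (· ∈ B j)) (hdisj : Pairwise (Function.onFun Disjoint B))
    (hBD : ∀ j, B j ⊆ D) (hcov : ∀ᵐ x ∂μ, x ∈ D → ∃ j, x ∈ B j) (j₀ : J)
    (θ : ∀ j, PartialIso T μ (B j₀) (B j)) : OrbitSystem T μ D J where
  idx x := if h : ∃ j, x ∈ B j then h.choose else j₀
  move j x := (θ j).toFun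
    ((θ (if h : ∃ j, x ∈ B j then h.choose else j₀)).invFun x)
  locConst_idx := (AELocConst.pi hB).comp fun p : J → Prop => if h : ∃ j, p j then h.choose else j₀
  locPow_move j := (θ j).locPow_toFun.comp hT <| AELocPow.glue
    (k := fun x => if h : ∃ j, x ∈ B j then h.choose else j₀)
    ((AELocConst.pi hB).comp fun p : J → Prop => if h : ∃ j, p j then h.choose else j₀)
    (σ := fun i => (θ i).invFun) fun i => (θ i).locPow_invFun
  identities := by
    set k : X → J := fun x => if h : ∃ j, x ∈ B j then h.choose else j₀
    have hk : ∀ x j, x ∈ B j → k x = j := by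
      intro x j hx
      have hex : ∃ j, x ∈ B j := ⟨j, hx⟩
      simp only [k, hex, dif_pos]
      by_contra hne
      exact Set.disjoint_left.1 (hdisj hne) hex.choose_spec hx
    have h1 : ∀ᵐ x ∂μ, ∀ i, x ∈ B i → (θ i).invFun x ∈ B j₀ ∧ (θ i).toFun ((θ i).invFun x) = x :=
      ae_all_iff.2 fun i => by
        filter_upwards [(θ i).invFun_mem, (θ i).right_inv] with x h1 h2 hx using ⟨h1 hx, h2 hx⟩
    have h2 : ∀ᵐ x ∂μ, ∀ i j, (θ i).invFun x ∈ B j₀ →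
        (θ j).toFun ((θ i).invFun x) ∈ B j ∧
          (θ j).invFun ((θ j).toFun ((θ i).invFun x)) = (θ i).invFun x :=
      ae_all_iff.2 fun i => ae_all_iff.2 fun j => by
        filter_upwards [(θ i).locPow_invFun.ae_comp hT (θ j).toFun_mem,
          (θ i).locPow_invFun.ae_comp hT (θ j).left_inv] with x h1 h2 hx using ⟨h1 hx, h2 hx⟩
    filter_upwards [hcov, h1, h2] with x hx h1 h2 hxD
    obtain ⟨i, hi⟩ := hx hxD
    obtain ⟨h3, h4⟩ := h1 i hi
    have hki : k x = i := hk x i hi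
    have hm : ∀ j, (θ j).toFun ((θ (k x)).invFun x) ∈ B j := fun j => by
      rw [hki]; exact (h2 i j h3).1
    have hkm : ∀ j, k ((θ j).toFun ((θ (k x)).invFun x)) = j := fun j => hk _ _ (hm j)
    refine ⟨fun j => hBD j (hm j), hkm, fun l j => ?_, ?_⟩
    · change (θ l).toFun ((θ (k ((θ j).toFun ((θ (k x)).invFun x)))).invFun
        ((θ j).toFun ((θ (k x)).invFun x))) = (θ l).toFun ((θ (k x)).invFun x)
      rw [hkm j, hki, (h2 i j h3).2]
    · change (θ (k x)).toFun ((θ (k x)).invFun x) = x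
      rw [hki, h4]

lemma exists_of_partition [Finite J] (hT : MeasurePreserving T μ μ) {B : J → Set X}
    (hB : ∀ j, AELocConst μ (· ∈ B j)) (hdisj : Pairwise (Function.onFun Disjoint B))
    (hBD : ∀ j, B j ⊆ D) (hcov : ∀ᵐ x ∂μ, x ∈ D → ∃ j, x ∈ B j) (j₀ : J)
    (θ : ∀ j, PartialIso T μ (B j₀) (B j)) :
    ∃ R : OrbitSystem T μ D J, ∀ i, ∀ x ∈ B i, R.idx x = i ∧
      ∀ j, R.move j x = (θ j).toFun ((θ i).invFun x) := by
  refine ⟨ofPartition hT hB hdisj hBD hcov j₀ θ, fun i x hx => ?_⟩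
  have hi : (ofPartition hT hB hdisj hBD hcov j₀ θ).idx x = i := by
    have hex : ∃ j, x ∈ B j := ⟨i, hx⟩
    simp only [ofPartition, hex, dif_pos]
    by_contra hne
    exact Set.disjoint_left.1 (hdisj hne) hex.choose_spec hx
  refine ⟨hi, fun j => ?_⟩
  conv_rhs => rw [← hi]
  rfl

/-- Refinement of a system on the whole space by a system on one of the sets of its partition: the
latter is transported to all the other sets. -/
def prod [Countable I] [Countable J] (hT : MeasurePreserving T μ μ) (S : OrbitSystem T μ univ I)
    (i₀ : I) (R : OrbitSystem T μ {x | S.idx x = i₀} J) : OrbitSystem T μ univ (I × J) where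
  idx x := (S.idx x, R.idx (S.move i₀ x))
  move p x := S.move p.1 (R.move p.2 (S.move i₀ x))
  locConst_idx := S.locConst_idx.comp₂ (R.locConst_idx.comp_locPow hT (S.locPow_move i₀)) Prod.mk
  locPow_move p := (S.locPow_move _).comp hT ((R.locPow_move _).comp hT (S.locPow_move _))
  identities := by
    have hS := S.ae_identities_univ
    have hS₀ := (S.locPow_move i₀).ae_comp hT hS
    have hR := (S.locPow_move i₀).ae_comp hT R.identities
    have hSR : ∀ᵐ x ∂μ, ∀ j, OrbitIdentities univ S.idx S.move (R.move j (S.move i₀ x)) :=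
      ae_all_iff.2 fun j => ((R.locPow_move j).comp hT (S.locPow_move i₀)).ae_comp hT hS
    filter_upwards [hS, hR, hSR] with x hx hR hSR _
    have hR := hR (hx.idx_move i₀)
    have hback : ∀ i j, S.move i₀ (S.move i (R.move j (S.move i₀ x))) = R.move j (S.move i₀ x) := by
      intro i j
      have h := (hSR j).move_idx
      rwa [show S.idx (R.move j (S.move i₀ x)) = i₀ from hR.move_mem j,
        ← (hSR j).move_move i₀ i] at h
    refine ⟨fun _ => mem_univ _, fun p => ?_, fun p q => ?_, ?_⟩
    · exact Prod.ext ((hSR _).idx_move _) (by simp only [hback, hR.idx_move])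
    · simp only [hback, hR.move_move]
    · simp only [hR.move_idx, hx.move_move, hx.move_idx]

end OrbitSystem

/-- The set `{idx = j}` lies, up to a null set, either in `U` or in its complement. -/
def Decides {J : Type} (μ : Measure X) (idx : X → J) (U : Set X) (j : J) : Prop :=
  (∀ᵐ y ∂μ, idx y = j → y ∈ U) ∨ ∀ᵐ y ∂μ, idx y = j → y ∉ U

/-- Every system can be refined so that most of its sets are decided by a given set. -/
lemma exists_refinement_decides [IsProbabilityMeasure μ] [NullSingletonClass μ]
    (hT : Ergodic T μ) {I : Type} [Fintype I] (S : OrbitSystem T μ univ I) (i₀ : I) {U : Set X}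
    (hU : AELocConst μ (· ∈ U)) {ε : ENNReal} (hε : ε ≠ 0) :
    ∃ e > 0, ∃ R : OrbitSystem T μ {x | S.idx x = i₀} (Fin e → Bool),
      μ {x | ¬ Decides μ (S.prod hT.toMeasurePreserving i₀ R).idx U
        ((S.prod hT.toMeasurePreserving i₀ R).idx x)} < ε := by
  classical
  have hmp := hT.toMeasurePreserving
  set B : Set X := {x | S.idx x = i₀}
  have hB : AELocConst μ (· ∈ B) := S.locConst_idx.comp (· = i₀)
  -- the pattern of the class of a point with respect to `U`
  set P : X → I → Prop := fun x i => S.move i x ∈ U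
  have hP : AELocConst μ P := AELocConst.pi fun i => hU.comp_locPow hmp (S.locPow_move i)
  set r : ℕ := Fintype.card (I → Prop)
  have eP : (I → Prop) ≃ Fin r := Fintype.equivFin _
  obtain ⟨m, hm⟩ := ENNReal.exists_nat_mul_gt hε (ENNReal.natCast_ne_top r)
  have hMr : (r : ENNReal) < (2 ^ (m + 1) : ℕ) * ε := hm.trans_le (by
    gcongr
    exact (Nat.lt_two_pow_self).le.trans (Nat.pow_le_pow_right two_pos m.le_succ))
  obtain ⟨A, hA, hAd, hAB, hAc, hAm, bad, hbad, hgood⟩ :=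
    exists_equal_cut hB (hP.comp eP) (M := 2 ^ (m + 1)) (by positivity)
  have g : (Fin (m + 1) → Bool) ≃ Fin (2 ^ (m + 1)) := Fintype.equivFinOfCardEq (by simp)
  have hθ : ∀ j, Nonempty (PartialIso T μ (A (g fun _ => false)) (A (g j))) := fun j =>
    exists_partialIso hT (hA _) (hA _) (by rw [hAm, hAm])
  have θ := fun j => (hθ j).some
  obtain ⟨R, hR⟩ := OrbitSystem.exists_of_partition hmp (D := B) (B := fun j => A (g j))
    (fun j => hA (g j)) (fun i j hij => hAd (g.injective.ne hij))
      (fun j => hAB (g j)) (by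
        filter_upwards [hAc] with x hx hxB
        obtain ⟨j, hj⟩ := hx hxB
        exact ⟨g.symm j, by rwa [g.apply_symm_apply]⟩) (fun _ => false) θ
  refine ⟨m + 1, m.succ_pos, R, ?_⟩
  set S' := S.prod hmp i₀ R
  have hdec : ∀ p : I × (Fin (m + 1) → Bool), g p.2 ∉ bad → Decides μ S'.idx U p := by
    rintro ⟨i, j⟩ hj
    have key : ∀ᵐ y ∂μ, S'.idx y = (i, j) → S.move i₀ y ∈ A (g j) ∧
        (y ∈ U ↔ P (S.move i₀ y) i) := by
      filter_upwards [S.ae_identities_univ, (S.locPow_move i₀).ae_comp hmp hAc] with y hy hyc hij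
      have h1 : S.idx y = i := congrArg Prod.fst hij
      have h2 : R.idx (S.move i₀ y) = j := congrArg Prod.snd hij
      obtain ⟨l, hl⟩ := hyc (hy.idx_move i₀)
      have h3 : R.idx (S.move i₀ y) = g.symm l :=
        (hR (g.symm l) _ (by rwa [g.apply_symm_apply])).1
      have h4 : g j = l := by rw [← h2, h3, g.apply_symm_apply]
      refine ⟨h4 ▸ hl, ?_⟩
      simp only [P]
      rw [hy.move_move, ← h1, hy.move_idx]
    by_cases hex : ∃ z ∈ A (g j), P z i
    · obtain ⟨z, hz, hzi⟩ := hex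
      left
      filter_upwards [key] with y hy hyj
      obtain ⟨h1, h2⟩ := hy hyj
      have h3 := eP.injective (hgood _ hj _ h1 z hz)
      exact h2.2 (by rw [h3]; exact hzi)
    · right
      filter_upwards [key] with y hy hyj hyU
      obtain ⟨h1, h2⟩ := hy hyj
      exact hex ⟨_, h1, h2.1 hyU⟩
  have : Nonempty I := ⟨i₀⟩
  have hcount := S'.measure_idx_mem hmp nullMeasurableSet_univ
    (Finset.univ ×ˢ bad.map g.symm.toEmbedding)
  rw [univ_inter] at hcount
  calc μ {x | ¬ Decides μ S'.idx U (S'.idx x)}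
      ≤ μ {x | S'.idx x ∈ Finset.univ ×ˢ bad.map g.symm.toEmbedding} := by
        refine measure_mono fun x hx => ?_
        by_contra hcon
        refine hx (hdec _ fun hb => hcon ?_)
        refine Finset.mem_product.2 ⟨Finset.mem_univ _, Finset.mem_map.2 ⟨_, hb, ?_⟩⟩
        simp
    _ = bad.card / (2 ^ (m + 1) : ℕ) := by
        rw [hcount]
        simp only [Finset.card_product, Finset.card_univ, Finset.card_map, measure_univ,
          Fintype.card_prod, Nat.cast_mul, ← mul_div_assoc, mul_one]
        rw [ENNReal.mul_div_mul_left _ _ (by simp) (by simp)]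
        simp
    _ < ε := by
        refine ENNReal.div_lt_of_lt_mul' (lt_of_le_of_lt ?_ hMr)
        exact_mod_cast hbad

end OrbitSystem

/-! ### First return maps and Rokhlin towers -/

section Relating

variable {X : Type*} [TopologicalSpace X] [PolishSpace X] [MeasurableSpace X] [BorelSpace X]
  {μ : Measure X} {T : X ≃ₜ X}

/-- The first positive time at which the orbit of `x` under `T ^ s` visits `B`. -/
noncomputable def returnTime (T : X ≃ₜ X) (s : ℤ) (B : Set X) (x : X) : ℕ :=
  sInf {n | 0 < n ∧ (T ^ (s * n)) x ∈ B}

/-- The first return map to `B` under `T ^ s`. Only the values `1` and `-1` of `s` are used. -/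
noncomputable def returnMap (T : X ≃ₜ X) (s : ℤ) (B : Set X) (x : X) : X :=
  (T ^ (s * returnTime T s B x)) x

lemma returnTime_mem {s : ℤ} {B : Set X} {x : X} (h : ∃ n : ℕ, 0 < n ∧ (T ^ (s * n)) x ∈ B) :
    0 < returnTime T s B x ∧ returnMap T s B x ∈ B :=
  Nat.sInf_mem (s := {n : ℕ | 0 < n ∧ (T ^ (s * n)) x ∈ B}) h

lemma returnTime_le {s : ℤ} {B : Set X} {x : X} {n : ℕ} (hn : 0 < n) (h : (T ^ (s * n)) x ∈ B) :
    returnTime T s B x ≤ n := Nat.sInf_le ⟨hn, h⟩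

lemma returnMap_returnMap {s : ℤ} {B : Set X} {x : X} (hx : x ∈ B)
    (h : ∃ n : ℕ, 0 < n ∧ (T ^ (s * n)) x ∈ B) :
    returnMap T (-s) B (returnMap T s B x) = x := by
  obtain ⟨hpos, -⟩ := returnTime_mem h
  have hback : ∀ k : ℕ, (T ^ (-s * k)) (returnMap T s B x) =
      (T ^ (s * ((returnTime T s B x : ℤ) - k))) x := by
    intro k
    rw [returnMap, ← homeo_zpow_add_apply]
    congr 2
    ring
  have hself : (T ^ (-s * returnTime T s B x)) (returnMap T s B x) = x := by
    rw [hback]; simp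
  have htime : returnTime T (-s) B (returnMap T s B x) = returnTime T s B x := by
    apply le_antisymm
    · exact returnTime_le hpos (by rwa [hself])
    · obtain ⟨hpos', hmem⟩ := returnTime_mem (T := T) (s := -s) (B := B)
        (x := returnMap T s B x) ⟨_, hpos, by rwa [hself]⟩
      by_contra! hlt
      rw [returnMap, hback] at hmem
      rw [← Nat.cast_sub hlt.le] at hmem
      have := returnTime_le (by omega) hmem
      omega
  rw [returnMap, htime, hself]

lemma ae_visits [IsFiniteMeasure μ] (hT : Ergodic T μ) {C : Set X} (hC : NullMeasurableSet C μ)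
    (h0 : μ C ≠ 0) {s : ℤ} (hs : s = 1 ∨ s = -1) :
    ∀ᵐ x ∂μ, ∃ n : ℕ, 0 < n ∧ (T ^ (s * n)) x ∈ C := by
  rcases hs with rfl | rfl
  · filter_upwards [ae_exists_pow_mem hT hC h0] with x ⟨n, hn, hx⟩
    exact ⟨n, hn, by simpa using hx⟩
  · filter_upwards [ae_exists_pow_mem (ergodic_homeo_symm hT) hC h0] with x ⟨n, hn, hx⟩
    exact ⟨n, hn, by simpa using hx⟩

lemma AELocPow.returnMap (hT : MeasurePreserving T μ μ) {B : Set X} (hB : AELocConst μ (· ∈ B))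
    {s : ℤ} (h : ∀ᵐ x ∂μ, ∃ n : ℕ, 0 < n ∧ (T ^ (s * n)) x ∈ B) :
    AELocPow T μ (returnMap T s B) := by
  refine AELocPow.glue (k := returnTime T s B) (σ := fun n x => (T ^ (s * n)) x) ?_
    fun n => .zpow _
  exact AELocConst.sInf (fun n => (AELocConst.const _).and (hB.comp_zpow hT _)) h

/-- The first return map, as a partial isomorphism. -/
noncomputable def returnIso [IsFiniteMeasure μ] (hT : Ergodic T μ) {B : Set X}
    (hB : AELocConst μ (· ∈ B)) (h0 : μ B ≠ 0) : PartialIso T μ B B where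
  toFun := returnMap T 1 B
  invFun := returnMap T (-1) B
  locPow_toFun := .returnMap hT.toMeasurePreserving hB
    (ae_visits hT hB.nullMeasurableSet h0 (Or.inl rfl))
  locPow_invFun := .returnMap hT.toMeasurePreserving hB
    (ae_visits hT hB.nullMeasurableSet h0 (Or.inr rfl))
  toFun_mem := by
    filter_upwards [ae_visits hT hB.nullMeasurableSet h0 (Or.inl rfl)] with x hx _
    exact (returnTime_mem hx).2
  invFun_mem := by
    filter_upwards [ae_visits hT hB.nullMeasurableSet h0 (Or.inr rfl)] with x hx _
    exact (returnTime_mem hx).2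
  left_inv := by
    filter_upwards [ae_visits hT hB.nullMeasurableSet h0 (Or.inl rfl)] with x hx hxB
    exact returnMap_returnMap hxB hx
  right_inv := by
    filter_upwards [ae_visits hT hB.nullMeasurableSet h0 (Or.inr rfl)] with x hx hxB
    exact returnMap_returnMap hxB hx

lemma PartialIso.exists_iterate (hT : MeasurePreserving T μ μ) {A : ℕ → Set X} {σ τ : X → X}
    (n : ℕ) (h : ∀ i < n, ∃ θ : PartialIso T μ (A i) (A (i + 1)), θ.toFun = σ ∧ θ.invFun = τ) :
    ∃ θ : PartialIso T μ (A 0) (A n), θ.toFun = σ^[n] ∧ θ.invFun = τ^[n] := by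
  induction n with
  | zero => exact ⟨.refl _, rfl, rfl⟩
  | succ n ih =>
    obtain ⟨θ, h1, h2⟩ := ih fun i hi => h i (hi.trans n.lt_succ_self)
    obtain ⟨η, h3, h4⟩ := h n n.lt_succ_self
    refine ⟨θ.trans hT η, ?_, ?_⟩
    · rw [Function.iterate_succ', ← h1, ← h3]; rfl
    · rw [Function.iterate_succ, ← h2, ← h4]; rfl

/-- An orbit which visits `C ⊆ B` in the past does so along the backward first return map
to `B`. -/
lemma exists_iterate_returnMap_mem {B C : Set X} (hCB : C ⊆ B) (m : ℕ) {x : X}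
    (h : (T ^ (-1 * (m : ℤ))) x ∈ C) : ∃ k, (returnMap T (-1) B)^[k] x ∈ C := by
  induction m using Nat.strong_induction_on generalizing x with
  | _ m ih =>
    rcases m.eq_zero_or_pos with rfl | hm
    · exact ⟨0, by simpa using h⟩
    · obtain ⟨hpos, -⟩ := returnTime_mem ⟨m, hm, hCB h⟩
      have hle := returnTime_le hm (hCB h)
      obtain ⟨k, hk⟩ := ih (m - returnTime T (-1) B x) (by omega)
        (x := returnMap T (-1) B x) (by
          rw [returnMap, ← homeo_zpow_add_apply]
          convert h using 2
          push_cast [hle]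
          congr 1
          ring)
      exact ⟨k + 1, hk⟩

/-- The number of steps of the backward first return map to `B` needed to reach `C`; zero outside
`B`. -/
noncomputable def backTime (T : X ≃ₜ X) (B C : Set X) (x : X) : ℕ :=
  sInf {k | (returnMap T (-1) B)^[k] x ∈ C ∨ x ∉ B}

lemma backTime_of_mem {B C : Set X} {x : X} (hx : x ∈ C) : backTime T B C x = 0 :=
  Nat.sInf_eq_zero.2 (Or.inl (Or.inl hx))

lemma backTime_succ {B C : Set X} {x y : X} (hx : x ∈ B) (hy : y ∈ B) (hyC : y ∉ C)
    (hxy : returnMap T (-1) B y = x) (hex : ∃ k, (returnMap T (-1) B)^[k] x ∈ C) :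
    backTime T B C y = backTime T B C x + 1 := by
  have hmem : (returnMap T (-1) B)^[backTime T B C x] x ∈ C ∨ x ∉ B :=
    Nat.sInf_mem (s := {k | (returnMap T (-1) B)^[k] x ∈ C ∨ x ∉ B})
      (hex.imp fun k hk => Or.inl hk)
  have hmem' : (returnMap T (-1) B)^[backTime T B C x + 1] y ∈ C := by
    rw [Function.iterate_succ_apply, hxy]
    exact hmem.resolve_right (not_not.2 hx)
  apply le_antisymm
  · exact Nat.sInf_le (Or.inl hmem')
  · refine le_csInf ⟨_, Or.inl hmem'⟩ ?_
    rintro (_ | k) (hk | hk)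
    · exact absurd hk hyC
    · exact absurd hy hk
    · rw [Function.iterate_succ_apply, hxy] at hk
      exact Nat.succ_le_succ (Nat.sInf_le (Or.inl hk))
    · exact absurd hy hk

/-- The points in position `i` of a complete block of length `M`: the orbits of the first return map
to `B` are cut at the visits to `C`, and each of the resulting segments is divided from the left
into blocks of length `M` and an incomplete remainder. -/
def blockSet (T : X ≃ₜ X) (B C : Set X) (M i : ℕ) : Set X :=
  {x | x ∈ B ∧ backTime T B C x % M = i ∧
    ∀ j : Fin M, 0 < (j : ℕ) → j + i < M → (returnMap T 1 B)^[j] x ∉ C}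

/-- A set `B` carries a finite relation, with classes of size `M`, such that most points of `B` are
related to their successors under the first return map. The exceptions are those whose successor
lies in a set `N` of small measure. -/
lemma exists_block_system [IsProbabilityMeasure μ] [NullSingletonClass μ] (hT : Ergodic T μ)
    {B : Set X} (hB : AELocConst μ (· ∈ B)) (h0 : μ B ≠ 0) {M : ℕ} (hM : 0 < M) {δ : ENNReal}
    (hδ : δ ≠ 0) :
    ∃ (R : OrbitSystem T μ B (Fin M)) (N : Set X), NullMeasurableSet N μ ∧
      μ N ≤ (M : ENNReal)⁻¹ + δ ∧ ∀ᵐ x ∂μ, x ∈ B → returnMap T 1 B x ∉ N →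
        R.move (R.idx (returnMap T 1 B x)) x = returnMap T 1 B x := by
  have hmp := hT.toMeasurePreserving
  have hM0 : (M : ENNReal) ≠ 0 := by simpa using hM.ne'
  obtain ⟨C, hCB, hC, hC0, hCδ⟩ := exists_small_subset hB h0
    (ENNReal.div_ne_zero.2 ⟨hδ, ENNReal.natCast_ne_top M⟩)
  set ρ := returnIso hT hB h0
  have hρ : ρ.toFun = returnMap T 1 B := rfl
  have hρ' : ρ.invFun = returnMap T (-1) B := rfl
  have hvis : ∀ᵐ x ∂μ, ∃ k, (returnMap T (-1) B)^[k] x ∈ C := by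
    filter_upwards [ae_visits hT hC.nullMeasurableSet hC0 (Or.inr rfl)] with x ⟨n, _, hn⟩
    exact exists_iterate_returnMap_mem hCB n hn
  have hback : AELocConst μ (backTime T B C) := by
    refine AELocConst.sInf (fun k => ?_) ?_
    · exact (hC.comp_locPow hmp (ρ.locPow_invFun.iterate hmp k)).or hB.not
    · filter_upwards [hvis] with x ⟨k, hk⟩ using ⟨k, Or.inl hk⟩
  set A : ℕ → Set X := blockSet T B C M
  have hA : ∀ i, AELocConst μ (· ∈ A i) := by
    intro i
    refine hB.and ((hback.comp (· % M = i)).and ?_)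
    exact (AELocConst.pi fun j : Fin M => hC.comp_locPow hmp (ρ.locPow_toFun.iterate hmp j)).comp
      fun p : Fin M → Prop => ∀ j : Fin M, 0 < (j : ℕ) → j + i < M → ¬ p j
  have hstep : ∀ i, i + 1 < M → ∃ θ : PartialIso T μ (A i) (A (i + 1)),
      θ.toFun = returnMap T 1 B ∧ θ.invFun = returnMap T (-1) B := by
    intro i hi
    have hto : ∀ᵐ x ∂μ, x ∈ A i → returnMap T 1 B x ∈ A (i + 1) := by
      filter_upwards [ρ.toFun_mem, ρ.left_inv, hvis] with x h1 h2 hk ⟨hxB, hxm, hxC⟩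
      have hyC : returnMap T 1 B x ∉ C := hxC ⟨1, by omega⟩ one_pos (by simp; omega)
      refine ⟨h1 hxB, ?_, fun j hj hji => ?_⟩
      · have ht : backTime T B C (returnMap T 1 B x) = _ :=
          backTime_succ hxB (h1 hxB) hyC (h2 hxB) hk
        rw [ht, Nat.add_mod, hxm,
          Nat.mod_eq_of_lt (show 1 < M by omega), Nat.mod_eq_of_lt hi]
      · exact hxC ⟨j + 1, by omega⟩ (by simp) (by simp; omega)
    have hfrom : ∀ᵐ x ∂μ, x ∈ A (i + 1) → returnMap T (-1) B x ∈ A i := by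
      filter_upwards [ρ.invFun_mem, ρ.right_inv, ρ.locPow_invFun.ae_comp hmp hvis]
        with x h1 h2 hk ⟨hxB, hxm, hxC⟩
      have hxC' : x ∉ C := by
        intro h
        rw [backTime_of_mem h] at hxm
        simp at hxm
      have ht := backTime_succ (h1 hxB) hxB hxC' rfl hk
      have hr : returnMap T 1 B (returnMap T (-1) B x) = x := h2 hxB
      refine ⟨h1 hxB, ?_, fun j hj hji => ?_⟩
      · have h3 := Nat.mod_add_div (backTime T B C x) M
        rw [hxm, ht] at h3
        have h4 : backTime T B C (ρ.invFun x) =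
            i + M * ((backTime T B C (ρ.invFun x) + 1) / M) := by omega
        change backTime T B C (ρ.invFun x) % M = i
        rw [h4, Nat.add_mul_mod_self_left, Nat.mod_eq_of_lt (by omega)]
      · obtain ⟨k, hk⟩ := Nat.exists_eq_succ_of_ne_zero hj.ne'
        rw [hk, Nat.succ_eq_add_one, Function.iterate_succ_apply, hr]
        rcases k.eq_zero_or_pos with rfl | hkpos
        · exact hxC'
        · exact hxC ⟨k, by omega⟩ hkpos (by simp; omega)
    exact ⟨{
      toFun := returnMap T 1 B
      invFun := returnMap T (-1) B
      locPow_toFun := ρ.locPow_toFun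
      locPow_invFun := ρ.locPow_invFun
      toFun_mem := hto
      invFun_mem := hfrom
      left_inv := by filter_upwards [ρ.left_inv] with x h hx using h hx.1
      right_inv := by filter_upwards [ρ.right_inv] with x h hx using h hx.1 }, rfl, rfl⟩
  have hθ : ∀ i : Fin M, ∃ θ : PartialIso T μ (A 0) (A i),
      θ.toFun = (returnMap T 1 B)^[i] ∧ θ.invFun = (returnMap T (-1) B)^[i] := fun i =>
    PartialIso.exists_iterate hmp i fun k hk => hstep k (by omega)
  choose θ hθ1 hθ2 using hθ
  -- The points outside complete blocks return to `C` within `M` steps, hence form a small set. They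
  -- are distributed equally among the positions to make the sets `A i` a partition of `B`.
  set P : Set X := {x | x ∈ B ∧ ∀ i : Fin M, x ∉ A i}
  have hP : AELocConst μ (· ∈ P) := hB.and
    ((AELocConst.pi fun i : Fin M => hA i).comp fun p : Fin M → Prop => ∀ i, ¬ p i)
  have hPm : μ P ≤ δ := by
    have hit : ∀ j : ℕ, μ (B ∩ {x | (returnMap T 1 B)^[j] x ∈ C}) ≤ μ C := by
      intro j
      obtain ⟨η, h1, h2⟩ := PartialIso.exists_iterate hmp (A := fun _ => B) j
        fun i _ => ⟨ρ, hρ, hρ'⟩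
      refine η.locPow_toFun.measure_le hmp (τ := η.invFun) ?_ ?_
      · exact hB.nullMeasurableSet.inter
          (hC.comp_locPow hmp (ρ.locPow_toFun.iterate hmp j)).nullMeasurableSet_setOf
      · filter_upwards [η.left_inv] with x hx hxB
        exact ⟨h1 ▸ hxB.2, hx hxB.1⟩
    calc μ P ≤ μ (⋃ j : Fin M, B ∩ {x | (returnMap T 1 B)^[j] x ∈ C}) := by
          refine measure_mono fun x hx => ?_
          by_contra hcon
          refine hx.2 ⟨_, Nat.mod_lt (backTime T B C x) hM⟩ ⟨hx.1, rfl, fun j _ _ hj => hcon ?_⟩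
          exact mem_iUnion.2 ⟨j, hx.1, hj⟩
      _ ≤ ∑ j : Fin M, μ (B ∩ {x | (returnMap T 1 B)^[j] x ∈ C}) := measure_iUnion_fintype_le _ _
      _ ≤ ∑ _j : Fin M, μ C := Finset.sum_le_sum fun j _ => hit j
      _ = M * μ C := by simp
      _ ≤ M * (δ / M) := by gcongr
      _ = δ := ENNReal.mul_div_cancel hM0 (by simp)
  obtain ⟨Q, hQ, hQd, hQP, hQc, hQm, -⟩ := exists_equal_cut (r := 1) (Q := fun _ => 0) hP
    (AELocConst.const _) hM
  have hη : ∀ j, Nonempty (PartialIso T μ (Q ⟨0, hM⟩) (Q j)) := fun j =>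
    exists_partialIso hT (hQ _) (hQ _) (by rw [hQm, hQm])
  have η := fun j => (hη j).some
  have hAQ : ∀ i j : Fin M, Disjoint (A i) (Q j) := fun i j =>
    Set.disjoint_left.2 fun x hx hx' => (hQP j hx').2 i hx
  have hAd : ∀ i j : Fin M, i ≠ j → Disjoint (A i) (A j) := fun i j hij =>
    Set.disjoint_left.2 fun x hx hx' => hij (Fin.ext (hx.2.1.symm.trans hx'.2.1))
  obtain ⟨R, hR⟩ := OrbitSystem.exists_of_partition hmp (D := B) (B := fun j : Fin M => A j ∪ Q j)
    (fun j => (hA j).or (hQ j)) (fun i j hij => by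
      refine Disjoint.union_left (Disjoint.union_right (hAd i j hij) (hAQ i j))
        (Disjoint.union_right (hAQ j i).symm (hQd hij)))
    (fun j => union_subset (fun x hx => hx.1) fun x hx => (hQP j hx).1)
    (by
      filter_upwards [hQc] with x hx hxB
      by_cases hxP : x ∈ P
      · obtain ⟨j, hj⟩ := hx hxP
        exact ⟨j, Or.inr hj⟩
      · simp only [P, mem_ofPred_eq, not_and, not_forall, not_not] at hxP
        obtain ⟨i, hi⟩ := hxP hxB
        exact ⟨i, Or.inl hi⟩)
    ⟨0, hM⟩ fun j => PartialIso.union (hA 0) (hA j) (hAQ ⟨0, hM⟩ ⟨0, hM⟩) (hAQ j j) (θ j) (η j)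
  refine ⟨R, A 0 ∪ P, (hA 0).nullMeasurableSet.union hP.nullMeasurableSet, ?_, ?_⟩
  · refine (measure_union_le _ _).trans (add_le_add ?_ hPm)
    have : Nonempty (Fin M) := ⟨⟨0, hM⟩⟩
    calc μ (A 0) ≤ μ (B ∩ {x | R.idx x ∈ ({⟨0, hM⟩} : Finset (Fin M))}) := by
          refine measure_mono fun x hx => ⟨hx.1, ?_⟩
          simpa using (hR ⟨0, hM⟩ x (Or.inl hx)).1
      _ = μ B / M := by rw [R.measure_idx_mem hmp hB.nullMeasurableSet]; simp
      _ ≤ (M : ENNReal)⁻¹ := by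
          rw [div_eq_mul_inv]
          exact mul_le_of_le_one_left' prob_le_one
  · have hfrom : ∀ᵐ x ∂μ, ∀ i, i + 1 < M → x ∈ A (i + 1) → returnMap T (-1) B x ∈ A i := by
      refine ae_all_iff.2 fun i => ?_
      by_cases hi : i + 1 < M
      · obtain ⟨ξ, -, h2⟩ := hstep i hi
        filter_upwards [ξ.invFun_mem] with x hx _
        rwa [h2] at hx
      · exact Eventually.of_forall fun x h => absurd h hi
    have hθr : ∀ᵐ x ∂μ, ∀ i : Fin M, x ∈ A i →
        (θ i).invFun x ∈ A 0 ∧ (θ i).toFun ((θ i).invFun x) = x := ae_all_iff.2 fun i => by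
      filter_upwards [(θ i).invFun_mem, (θ i).right_inv] with x h1 h2 hx using ⟨h1 hx, h2 hx⟩
    filter_upwards [ρ.toFun_mem, ρ.left_inv, ρ.locPow_toFun.ae_comp hmp hfrom, hθr]
      with x h1 h2 h3 h4 hxB hxN
    simp only [mem_union, not_or] at hxN
    obtain ⟨i, hi⟩ : ∃ i : Fin M, returnMap T 1 B x ∈ A i := by
      by_contra! hcon
      exact hxN.2 ⟨h1 hxB, hcon⟩
    obtain ⟨k, hk⟩ : ∃ k, (i : ℕ) = k + 1 := Nat.exists_eq_succ_of_ne_zero fun h =>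
      hxN.1 (by rwa [h] at hi)
    have hkM : k + 1 < M := hk ▸ i.2
    have hxk : x ∈ A k := by
      have := h3 k hkM (by rw [← hk]; exact hi)
      have h2' : returnMap T (-1) B (ρ.toFun x) = x := h2 hxB
      rwa [h2'] at this
    obtain ⟨h5, h6⟩ := h4 ⟨k, by omega⟩ hxk
    rw [(hR i _ (Or.inl hi)).1, (hR ⟨k, by omega⟩ x (Or.inl hxk)).2 i]
    simp only [PartialIso.union, hxk, if_true, h5]
    rw [hθ1, hk, Function.iterate_succ_apply']
    rw [hθ1] at h6
    exact congrArg _ h6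

end Relating

/-! ### Relating points to their images -/

section Relating

variable {X : Type*} [TopologicalSpace X] [PolishSpace X] [MeasurableSpace X] [BorelSpace X]
  {μ : Measure X} {T : X ≃ₜ X}

/-- Two points of `B` on the same orbit are related if every first return between them avoids the
exceptional set `N`. -/
lemma related_of_forall_notMem {B N : Set X} {J : Type} {R : OrbitSystem T μ B J} (k : ℕ) {y : X}
    (hid : ∀ n : ℤ, (T ^ n) y ∈ B → OrbitIdentities B R.idx R.move ((T ^ n) y))
    (hsucc : ∀ n : ℤ, (T ^ n) y ∈ B → returnMap T 1 B ((T ^ n) y) ∉ N →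
      R.move (R.idx (returnMap T 1 B ((T ^ n) y))) ((T ^ n) y) = returnMap T 1 B ((T ^ n) y))
    (hy : y ∈ B) (hk : (T ^ (k : ℤ)) y ∈ B)
    (hN : ∀ i : ℕ, 0 < i → i ≤ k → (T ^ (i : ℤ)) y ∉ N) :
    R.move (R.idx ((T ^ (k : ℤ)) y)) y = (T ^ (k : ℤ)) y := by
  induction k using Nat.strong_induction_on generalizing y with
  | _ k ih =>
    have hidy : OrbitIdentities B R.idx R.move y := by simpa using hid 0 (by simpa using hy)
    rcases k.eq_zero_or_pos with rfl | hkpos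
    · simpa using hidy.move_idx
    · have hk' : (T ^ (1 * (k : ℤ))) y ∈ B := by rwa [one_mul]
      obtain ⟨hpos, hzB⟩ := returnTime_mem (T := T) (s := 1) (B := B) (x := y) ⟨k, hkpos, hk'⟩
      have hle := returnTime_le hkpos hk'
      set r := returnTime T 1 B y
      have hz : returnMap T 1 B y = (T ^ (r : ℤ)) y := by rw [returnMap, one_mul]
      have hsucc0 : R.move (R.idx (returnMap T 1 B y)) y = returnMap T 1 B y := by
        simpa using hsucc 0 (by simpa using hy) (by simpa [hz] using hN r hpos hle)
      rw [hz] at hsucc0 hzB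
      have hshift : ∀ n : ℤ, (T ^ n) ((T ^ (r : ℤ)) y) = (T ^ (n + r)) y := fun n =>
        (homeo_zpow_add_apply T _ _ _).symm
      have hend : (T ^ ((k - r : ℕ) : ℤ)) ((T ^ (r : ℤ)) y) = (T ^ (k : ℤ)) y := by
        rw [hshift]
        congr 2
        omega
      have := ih (k - r) (by omega) (y := (T ^ (r : ℤ)) y)
        (fun n => by simpa only [hshift] using hid (n + r))
        (fun n => by simpa only [hshift] using hsucc (n + r)) hzB (by rwa [hend])
        (fun i hi hik => by
          rw [hshift]
          exact_mod_cast hN (i + r) (by omega) (by omega))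
      rw [hend, ← hsucc0, hidy.move_move] at this
      exact this

/-- The points `x` for which `σ` is, near `x`, one of the powers `T ^ n` with `|n| ≤ K` exhaust the
space up to a null set as `K` grows. -/
lemma AELocPow.exists_bound [IsFiniteMeasure μ] {σ : X → X} (hσ : AELocPow T μ σ) {ε : ENNReal}
    (hε : ε ≠ 0) : ∃ (K : ℕ) (E : Set X), MeasurableSet E ∧ μ E < ε ∧
      ∀ x ∉ E, ∃ n : ℤ, |n| ≤ K ∧ σ x = (T ^ n) x := by
  set G : ℕ → Set X := fun K => ⋃ n : ℤ, ⋃ _ : |n| ≤ K, {x | ∀ᶠ y in 𝓝 x, σ y = (T ^ n) y}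
  have hG : ∀ K, IsOpen (G K) := fun K =>
    isOpen_iUnion fun n => isOpen_iUnion fun _ => isOpen_setOfPred_eventually_nhds
  have hanti : Antitone fun K => (G K)ᶜ := by
    intro K L hKL
    refine compl_subset_compl.2 (iUnion_mono fun n => iUnion_mono' fun h => ⟨h.trans ?_, le_rfl⟩)
    exact_mod_cast hKL
  have hnull : μ (⋂ K, (G K)ᶜ) = 0 := by
    refine measure_mono_null (t := {x | ¬ ∃ n : ℤ, ∀ᶠ y in 𝓝 x, σ y = (T ^ n) y}) ?_ hσ
    rintro x hx ⟨n, hn⟩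
    refine mem_iInter.1 hx n.natAbs (mem_iUnion.2 ⟨n, mem_iUnion.2 ⟨?_, hn⟩⟩)
    simp
  have hlim := tendsto_measure_iInter_atTop (μ := μ)
    (fun K => (hG K).measurableSet.compl.nullMeasurableSet) hanti ⟨0, measure_ne_top _ _⟩
  rw [hnull] at hlim
  obtain ⟨K, hK⟩ := ((tendsto_order.1 hlim).2 ε (pos_iff_ne_zero.2 hε)).exists
  refine ⟨K, (G K)ᶜ, (hG K).measurableSet.compl, hK, fun x hx => ?_⟩
  obtain ⟨n, hn⟩ := mem_iUnion.1 (not_not.1 hx)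
  obtain ⟨hn, hx⟩ := mem_iUnion.1 hn
  exact ⟨n, hn, hx.self_of_nhds⟩

/-- Every system can be refined so that most points `x` are related to `T x`. -/
lemma exists_refinement_related [IsProbabilityMeasure μ] [NullSingletonClass μ]
    (hT : Ergodic T μ) {I : Type} [Fintype I] (S : OrbitSystem T μ univ I) (i₀ : I) {ε : ENNReal}
    (hε : ε ≠ 0) (hε' : ε ≠ ⊤) :
    ∃ e > 0, ∃ R : OrbitSystem T μ {x | S.idx x = i₀} (Fin e → Bool),
      μ {x | (S.prod hT.toMeasurePreserving i₀ R).move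
        ((S.prod hT.toMeasurePreserving i₀ R).idx (T x)) x ≠ T x} < ε := by
  classical
  have hmp := hT.toMeasurePreserving
  have : Nonempty I := ⟨i₀⟩
  set B : Set X := {x | S.idx x = i₀}
  have hB : AELocConst μ (· ∈ B) := S.locConst_idx.comp (· = i₀)
  have hB0 : μ B ≠ 0 := by
    have h := S.measure_idx_mem hmp nullMeasurableSet_univ {i₀}
    simp only [univ_inter, Finset.mem_singleton] at h
    change μ {x | S.idx x = i₀} ≠ 0
    rw [h]
    simp
  obtain ⟨K, E, hEm, hE, hEK⟩ := (S.locPow_move i₀).exists_bound (μ := μ)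
    (ε := ε / 4) (ENNReal.div_ne_zero.2 ⟨hε, by simp⟩)
  -- for most `x`, the representatives in `B` of `x` and of `T x` are `T ^ p x` and `T ^ q x` with
  -- `p` and `q` in a window of `L` exponents
  set L : ℕ := 2 * (K + 1) + 1
  set η : ENNReal := ε / 4 / L
  have hη : η ≠ 0 := ENNReal.div_ne_zero.2 ⟨ENNReal.div_ne_zero.2 ⟨hε, by simp⟩, by simp⟩
  obtain ⟨m, hm⟩ := ENNReal.exists_inv_nat_lt hη
  have hMη : ((2 ^ (m + 1) : ℕ) : ENNReal)⁻¹ ≤ η := by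
    refine le_trans (ENNReal.inv_le_inv.2 ?_) hm.le
    exact_mod_cast (Nat.lt_two_pow_self).le.trans (Nat.pow_le_pow_right two_pos m.le_succ)
  obtain ⟨R₀, N, hNm, hN, hR₀⟩ := exists_block_system hT hB hB0
    (M := 2 ^ (m + 1)) (by positivity) hη
  have g : Fin (2 ^ (m + 1)) ≃ (Fin (m + 1) → Bool) :=
    (Fintype.equivFinOfCardEq (by simp)).symm
  set R : OrbitSystem T μ B (Fin (m + 1) → Bool) := R₀.reindex g
  have hR : ∀ᵐ x ∂μ, x ∈ B → returnMap T 1 B x ∉ N →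
      R.move (R.idx (returnMap T 1 B x)) x = returnMap T 1 B x := by
    filter_upwards [hR₀] with x hx hxB hxN
    have := hx hxB hxN
    simpa [R, OrbitSystem.reindex] using this
  refine ⟨m + 1, m.succ_pos, R, ?_⟩
  set W : Finset ℤ := Finset.Icc (-(K + 1 : ℤ)) (K + 1)
  have hW : W.card = L := by simp [W, L]; omega
  have hsub : ∀ᵐ x ∂μ, x ∉ E → T x ∉ E → (∀ i ∈ W, (T ^ i) x ∉ N) →
      (S.prod hmp i₀ R).move ((S.prod hmp i₀ R).idx (T x)) x = T x := by
    filter_upwards [ae_forall_zpow hmp S.ae_identities_univ, ae_forall_zpow hmp R.identities,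
      ae_forall_zpow hmp hR] with x hS hRid hRs hx hTx hxN
    obtain ⟨p, hp, hpx⟩ := hEK x hx
    obtain ⟨q', hq', hqx'⟩ := hEK _ hTx
    have hTx1 : (T ^ (1 : ℤ)) x = T x := by rw [zpow_one]
    obtain ⟨q, hq, hqx⟩ : ∃ q : ℤ, |q| ≤ K + 1 ∧ S.move i₀ (T x) = (T ^ q) x := by
      refine ⟨q' + 1, (abs_add_le _ _).trans (by simpa using hq'), ?_⟩
      rw [hqx', homeo_zpow_add_apply, hTx1]
    have hS0 : OrbitIdentities univ S.idx S.move x := by simpa using hS 0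
    have hS1 : OrbitIdentities univ S.idx S.move (T x) := hTx1 ▸ hS 1
    have hpB : (T ^ p) x ∈ B := hpx ▸ hS0.idx_move i₀
    have hqB : (T ^ q) x ∈ B := hqx ▸ hS1.idx_move i₀
    have hshift : ∀ m n : ℤ, (T ^ n) ((T ^ m) x) = (T ^ (n + m)) x := fun m n =>
      (homeo_zpow_add_apply T _ _ _).symm
    rw [abs_le] at hp hq
    have hrel : ∀ a b : ℤ, a ≤ b → -(K + 1 : ℤ) ≤ a → b ≤ K + 1 → (T ^ a) x ∈ B → (T ^ b) x ∈ B →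
        R.move (R.idx ((T ^ b) x)) ((T ^ a) x) = (T ^ b) x := by
      intro a b hab ha hb haB hbB
      have hba : (T ^ ((b - a).toNat : ℤ)) ((T ^ a) x) = (T ^ b) x := by
        rw [hshift]; congr 2; omega
      have := related_of_forall_notMem (R := R) (N := N) (b - a).toNat (y := (T ^ a) x)
        (fun n => by rw [hshift]; exact hRid _) (fun n => by rw [hshift]; exact hRs _) haB
        (by rwa [hba]) (fun i hi hi' => by
          rw [hshift]
          exact hxN _ (Finset.mem_Icc.2 ⟨by omega, by omega⟩))
      rwa [hba] at this
    have hpq : R.move (R.idx ((T ^ q) x)) ((T ^ p) x) = (T ^ q) x := by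
      rcases le_total p q with h | h
      · exact hrel p q h (by omega) hq.2 hpB hqB
      · have h1 := hrel q p h hq.1 (by omega) hqB hpB
        have h2 := (hRid q hqB).move_move (R.idx ((T ^ q) x)) (R.idx ((T ^ p) x))
        rwa [h1, (hRid q hqB).move_idx] at h2
    change S.move (S.idx (T x)) (R.move (R.idx (S.move i₀ (T x))) (S.move i₀ x)) = T x
    rw [hqx, hpx, hpq, ← hqx, hS1.move_move, hS1.move_idx]
  have hpow : ∀ i : ℤ, μ ((T ^ i : X ≃ₜ X) ⁻¹' N) = μ N := fun i =>
    (measurePreserving_zpow hmp i).measure_preimage hNm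
  calc μ {x | (S.prod hmp i₀ R).move ((S.prod hmp i₀ R).idx (T x)) x ≠ T x}
      ≤ μ ((E ∪ T ⁻¹' E) ∪ ⋃ i ∈ W, (T ^ i : X ≃ₜ X) ⁻¹' N) := by
        apply measure_mono_ae
        filter_upwards [hsub] with x hx hne
        by_contra hcon
        have hcon' : x ∉ (E ∪ T ⁻¹' E) ∪ ⋃ i ∈ W, (T ^ i : X ≃ₜ X) ⁻¹' N := hcon
        simp only [mem_union, mem_preimage, mem_iUnion, not_or, not_exists] at hcon'
        exact hne (hx hcon'.1.1 hcon'.1.2 hcon'.2)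
    _ ≤ (μ E + μ (T ⁻¹' E)) + ∑ i ∈ W, μ ((T ^ i : X ≃ₜ X) ⁻¹' N) :=
        (measure_union_le _ _).trans
          (add_le_add (measure_union_le _ _) (measure_biUnion_finset_le _ _))
    _ = (μ E + μ E) + L * μ N := by
        simp_rw [hpow, hmp.measure_preimage hEm.nullMeasurableSet]
        simp [hW]
    _ ≤ (μ E + μ E) + L * (η + η) := by
        gcongr
        exact hN.trans (by gcongr)
    _ = (μ E + μ E) + (ε / 4 + ε / 4) := by
        rw [← two_mul η, mul_left_comm, ENNReal.mul_div_cancel (by simp [L]) (by simp), two_mul]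
    _ < (ε / 4 + ε / 4) + (ε / 4 + ε / 4) := by
        refine ENNReal.add_lt_add_right ?_ (ENNReal.add_lt_add hE hE)
        exact ENNReal.add_ne_top.2 ⟨ENNReal.div_ne_top hε' (by simp),
          ENNReal.div_ne_top hε' (by simp)⟩
    _ = ε := by
        have h4 : (ε / 4 + ε / 4) + (ε / 4 + ε / 4) = 4 * (ε / 4) := by ring
        rw [h4, ENNReal.mul_div_cancel (by simp) (by simp)]

end Relating

/-! ### Refining sequences of stages -/

section Stages

variable {X : Type*} [TopologicalSpace X] [PolishSpace X] [MeasurableSpace X] [BorelSpace X]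
  {μ : Measure X} {T : X ≃ₜ X}

/-- A finite subrelation of the orbit relation whose classes are enumerated by binary words of some
length. -/
structure Stage (T : X ≃ₜ X) (μ : Measure X) where
  len : ℕ
  sys : OrbitSystem T μ univ (Fin len → Bool)

/-- The word obtained from `v` by replacing its first letters by those of `w`. -/
def overwrite {d d' : ℕ} (w : Fin d → Bool) (v : Fin d' → Bool) : Fin d' → Bool :=
  fun i => if h : (i : ℕ) < d then w ⟨i, h⟩ else v i

/-- `S'` refines `S`: the index in `S'` extends the index in `S`, and moving in `S` changes an
initial segment of the index in `S'` while keeping the other letters. -/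
structure Stage.Refines (S S' : Stage T μ) : Prop where
  lt : S.len < S'.len
  idx_eq : ∀ᵐ x ∂μ, ∀ i : Fin S.len, S'.sys.idx x (Fin.castLE lt.le i) = S.sys.idx x i
  move_eq : ∀ᵐ x ∂μ, ∀ w, S.sys.move w x = S'.sys.move (overwrite w (S'.sys.idx x)) x

/-- The points lying in a set of the partition which, even up to null sets, neither is contained in
`U` nor misses `U`. -/
def Stage.undecided (S : Stage T μ) (U : Set X) : Set X :=
  {x | ¬ Decides μ S.sys.idx U (S.sys.idx x)}

/-- The points which are not related to their image under `T`. -/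
def Stage.unrelated (S : Stage T μ) : Set X := {x | S.sys.move (S.sys.idx (T x)) x ≠ T x}

lemma Stage.exists_refines (hT : MeasurePreserving T μ μ) (S : Stage T μ) {e : ℕ} (he : 0 < e)
    (i₀ : Fin S.len → Bool) (R : OrbitSystem T μ {x | S.sys.idx x = i₀} (Fin e → Bool)) :
    ∃ S' : Stage T μ, S.Refines S' ∧ (∀ U, S'.undecided U =
      {x | ¬ Decides μ (S.sys.prod hT i₀ R).idx U ((S.sys.prod hT i₀ R).idx x)}) ∧
      S'.unrelated =
        {x | (S.sys.prod hT i₀ R).move ((S.sys.prod hT i₀ R).idx (T x)) x ≠ T x} := by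
  set c := Fin.appendEquiv (α := Bool) S.len e
  refine ⟨⟨S.len + e, (S.sys.prod hT i₀ R).reindex c⟩, ⟨?_, ?_, ?_⟩, fun U => ?_, ?_⟩
  · exact Nat.lt_add_of_pos_right he
  · refine Eventually.of_forall fun x i => ?_
    change Fin.append (S.sys.idx x) (R.idx (S.sys.move i₀ x)) (Fin.castAdd e i) = _
    rw [Fin.append_left]
  · filter_upwards [S.sys.ae_identities_univ, (S.sys.locPow_move i₀).ae_comp hT R.identities]
      with x hx hR w
    have hR := hR (hx.idx_move i₀)
    have hw : overwrite w (c ((S.sys.prod hT i₀ R).idx x)) =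
        c (w, R.idx (S.sys.move i₀ x)) := by
      ext i
      refine Fin.addCases (fun i => ?_) (fun i => ?_) i
      · change _ = Fin.append w _ _
        rw [Fin.append_left]
        simp [overwrite]
      · change _ = Fin.append w _ _
        rw [Fin.append_right]
        have : overwrite w (c ((S.sys.prod hT i₀ R).idx x)) (Fin.natAdd S.len i) =
            Fin.append (S.sys.idx x) (R.idx (S.sys.move i₀ x)) (Fin.natAdd S.len i) := by
          simp only [overwrite, Fin.val_natAdd, add_lt_iff_neg_left, not_lt_zero, dite_false]
          rfl
        rw [this, Fin.append_right]
    change _ = (S.sys.prod hT i₀ R).move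
      (c.symm (overwrite w (c ((S.sys.prod hT i₀ R).idx x)))) x
    rw [hw, c.symm_apply_apply]
    change _ = S.sys.move w (R.move (R.idx (S.sys.move i₀ x)) (S.sys.move i₀ x))
    rw [hR.move_idx, hx.move_move]
  · ext x
    simp [Stage.undecided, Decides, OrbitSystem.reindex]
  · ext x
    simp [Stage.unrelated, OrbitSystem.reindex]

lemma exists_stage_undecided_lt [IsProbabilityMeasure μ] [NullSingletonClass μ]
    (hT : Ergodic T μ) (S : Stage T μ) {U : Set X} (hU : AELocConst μ (· ∈ U)) {ε : ENNReal}
    (hε : ε ≠ 0) : ∃ S', S.Refines S' ∧ μ (S'.undecided U) < ε := by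
  obtain ⟨e, he, R, hR⟩ := exists_refinement_decides hT S.sys (fun _ => false) hU hε
  obtain ⟨S', h1, h2, -⟩ := S.exists_refines hT.toMeasurePreserving he _ R
  exact ⟨S', h1, by rwa [h2]⟩

lemma exists_stage_unrelated_lt [IsProbabilityMeasure μ] [NullSingletonClass μ]
    (hT : Ergodic T μ) (S : Stage T μ) {ε : ENNReal} (hε : ε ≠ 0) (hε' : ε ≠ ⊤) :
    ∃ S', S.Refines S' ∧ μ S'.unrelated < ε := by
  obtain ⟨e, he, R, hR⟩ := exists_refinement_related hT S.sys (fun _ => false) hε hε'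
  obtain ⟨S', h1, -, h2⟩ := S.exists_refines hT.toMeasurePreserving he _ R
  exact ⟨S', h1, by rwa [h2]⟩

lemma exists_stages [IsProbabilityMeasure μ] [NullSingletonClass μ] (hT : Ergodic T μ)
    {U : ℕ → Set X} (hU : ∀ n, AELocConst μ (· ∈ U n)) :
    ∃ S : ℕ → Stage T μ, (∀ n, (S n).Refines (S (n + 1))) ∧
      (∀ m, ∀ᵐ x ∂μ, ∃ n, x ∉ (S n).undecided (U m)) ∧ ∀ᵐ x ∂μ, ∃ n, x ∉ (S n).unrelated := by
  -- every task is encoded by the first component of `n` for arbitrarily large `n`, so that it is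
  -- carried out with arbitrarily small exceptional sets
  have hnext : ∀ (n : ℕ) (S : Stage T μ), ∃ S', S.Refines S' ∧
      (n.unpair.1 = 0 → μ S'.unrelated < ((n + 1 : ℕ) : ENNReal)⁻¹) ∧
      ∀ m, n.unpair.1 = m + 1 → μ (S'.undecided (U m)) < ((n + 1 : ℕ) : ENNReal)⁻¹ := by
    intro n S
    have hε : ((n + 1 : ℕ) : ENNReal)⁻¹ ≠ 0 := ENNReal.inv_ne_zero.2 (ENNReal.natCast_ne_top _)
    have hε' : ((n + 1 : ℕ) : ENNReal)⁻¹ ≠ ⊤ := ENNReal.inv_ne_top.2 (by simp)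
    rcases h : n.unpair.1 with _ | m
    · obtain ⟨S', h1, h2⟩ := exists_stage_unrelated_lt hT S hε hε'
      exact ⟨S', h1, fun _ => h2, fun m hm => by simp at hm⟩
    · obtain ⟨S', h1, h2⟩ := exists_stage_undecided_lt hT S (hU m) hε
      refine ⟨S', h1, fun hm => by simp at hm, fun k hk => ?_⟩
      obtain rfl : m = k := by omega
      exact h2
  choose next hnext using hnext
  set S : ℕ → Stage T μ :=
    Nat.rec ⟨0, OrbitSystem.trivialSystem T μ _⟩ fun n S => next n S
  have hS : ∀ n, S (n + 1) = next n (S n) := fun n => rfl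
  have hzero : ∀ A : ℕ → Set X, (∀ k : ℕ, ∃ n, k ≤ n ∧ μ (A (n + 1)) < ((n + 1 : ℕ) : ENNReal)⁻¹) →
      ∀ᵐ x ∂μ, ∃ n, x ∉ A n := by
    intro A hA
    change μ {x | ¬ ∃ n, x ∉ A n} = 0
    by_contra hne
    obtain ⟨k, hk⟩ := ENNReal.exists_inv_nat_lt hne
    obtain ⟨n, hkn, hn⟩ := hA k
    have h1 : μ {x | ¬ ∃ n, x ∉ A n} ≤ μ (A (n + 1)) := by
      refine measure_mono fun x hx => ?_
      by_contra h
      exact hx ⟨_, h⟩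
    have h2 : ((n + 1 : ℕ) : ENNReal)⁻¹ ≤ (k : ENNReal)⁻¹ := by
      refine ENNReal.inv_le_inv.2 ?_
      exact_mod_cast hkn.trans n.le_succ
    exact absurd (h1.trans_lt (hn.trans_le (h2.trans hk.le))) (lt_irrefl _)
  refine ⟨S, fun n => (hnext n (S n)).1, fun m => ?_, ?_⟩
  · refine hzero (fun n => (S n).undecided (U m)) fun k => ⟨Nat.pair (m + 1) k,
      Nat.right_le_pair _ _, ?_⟩
    rw [hS]
    exact (hnext _ _).2.2 m (by simp)
  · refine hzero (fun n => (S n).unrelated) fun k => ⟨Nat.pair 0 k, Nat.right_le_pair _ _, ?_⟩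
    rw [hS]
    exact (hnext _ _).2.1 (by simp)

end Stages

section Coding

variable {X : Type*} [TopologicalSpace X] [PolishSpace X] [MeasurableSpace X] [BorelSpace X]
  {μ : Measure X} {T : X ≃ₜ X}

lemma AELocConst.ae_eventually {P : X → Prop} (hP : AELocConst μ P) (h : ∀ᵐ x ∂μ, P x) :
    ∀ᵐ x ∂μ, ∀ᶠ y in 𝓝 x, P y := by
  filter_upwards [hP, h] with x hx hPx
  filter_upwards [hx] with y hy
  rwa [hy]

/-- Countably many properties, each of which holds on an open set of full measure, hold
simultaneously on an invariant `G_δ` set of full measure. -/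
lemma exists_invariantGdeltaFull (hT : MeasurePreserving T μ μ) {ι : Type*} [Countable ι]
    {P : ι → X → Prop} (h : ∀ i, ∀ᵐ x ∂μ, ∀ᶠ y in 𝓝 x, P i y) :
    ∃ X' : Set X, IsInvariantGdeltaFull T μ X' ∧ ∀ x ∈ X', ∀ i, P i x := by
  set O : ι → Set X := fun i => {x | ∀ᶠ y in 𝓝 x, P i y}
  have hO : ∀ i, IsOpen (O i) := fun i => isOpen_setOfPred_eventually_nhds
  refine ⟨⋂ i, ⋂ n : ℤ, (T ^ n : X ≃ₜ X) ⁻¹' O i, ⟨?_, ?_, ?_⟩, ?_⟩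
  · exact .iInter fun i => .iInter fun n =>
      ((hO i).preimage (T ^ n : X ≃ₜ X).continuous).isGδ
  · have hT' : ∀ x, T.symm x = (T ^ (-1 : ℤ)) x := fun x => by rw [zpow_neg_one]; rfl
    rw [T.image_eq_preimage_symm]
    ext x
    simp only [mem_preimage, mem_iInter, hT', ← homeo_zpow_add_apply]
    exact forall_congr' fun i =>
      ⟨fun h n => by simpa using h (n + 1), fun h n => h (n + -1)⟩
  · rw [measure_eq_zero_iff_ae_notMem]
    filter_upwards [ae_all_iff.2 fun i => ae_forall_zpow hT (h i)] with x hx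
    exact not_not.2 (mem_iInter.2 fun i => mem_iInter.2 fun n => hx i n)
  · intro x hx i
    have := mem_iInter.1 (mem_iInter.1 hx i) 0
    exact (show ∀ᶠ y in 𝓝 x, P i y by simpa [O] using this).self_of_nhds

/-- The properties of a point, with respect to a refining sequence of stages and a base `U` of the
topology, which make its sequence of indices a good code. -/
structure GoodPoint (S : ℕ → Stage T μ) (U : ℕ → Set X) (x : X) : Prop where
  eventually_idx : ∀ n, ∀ᶠ y in 𝓝 x, (S n).sys.idx y = (S n).sys.idx x
  move_orbit : ∀ n w, ∃ a : ℤ, (S n).sys.move w x = (T ^ a) x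
  idx_move : ∀ n w, (S n).sys.idx ((S n).sys.move w x) = w
  idx_succ : ∀ n i (h : i < (S n).len) (h' : i < (S (n + 1)).len),
    (S (n + 1)).sys.idx x ⟨i, h'⟩ = (S n).sys.idx x ⟨i, h⟩
  move_succ : ∀ n w, (S n).sys.move w x =
    (S (n + 1)).sys.move (overwrite w ((S (n + 1)).sys.idx x)) x
  related : ∃ n, (S n).sys.move ((S n).sys.idx (T x)) x = T x
  decided : ∀ m, ∃ n, Decides μ (S n).sys.idx (U m) ((S n).sys.idx x)
  mem_of_ae : ∀ n m, (∀ᵐ y ∂μ, (S n).sys.idx y = (S n).sys.idx x → y ∈ U m) → x ∈ U m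
  notMem_of_ae : ∀ n m, (∀ᵐ y ∂μ, (S n).sys.idx y = (S n).sys.idx x → y ∉ U m) → x ∉ U m

lemma exists_goodPoints [IsProbabilityMeasure μ] [NullSingletonClass μ] (hT : Ergodic T μ)
    {S : ℕ → Stage T μ} {U : ℕ → Set X} (hU : ∀ n, AELocConst μ (· ∈ U n))
    (hS : ∀ n, (S n).Refines (S (n + 1))) (hdec : ∀ m, ∀ᵐ x ∂μ, ∃ n, x ∉ (S n).undecided (U m))
    (hrel : ∀ᵐ x ∂μ, ∃ n, x ∉ (S n).unrelated) :
    ∃ X' : Set X, IsInvariantGdeltaFull T μ X' ∧ ∀ x ∈ X', GoodPoint S U x := by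
  have hmp := hT.toMeasurePreserving
  have hap := ae_aperiodic hT
  have hidx : ∀ n, AELocConst μ (S n).sys.idx := fun n => (S n).sys.locConst_idx
  have h1 : ∀ n, ∀ᵐ x ∂μ, ∀ᶠ y in 𝓝 x, ∀ᶠ z in 𝓝 y, (S n).sys.idx z = (S n).sys.idx y := by
    intro n
    filter_upwards [hidx n] with x hx
    filter_upwards [eventually_eventually_nhds.2 hx, hx] with y hy hyx
    simpa only [hyx] using hy
  have h2 : ∀ p : (n : ℕ) × (Fin (S n).len → Bool), ∀ᵐ x ∂μ, ∀ᶠ y in 𝓝 x, ∃ a : ℤ,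
      (S p.1).sys.move p.2 y = (T ^ a) y := by
    intro p
    filter_upwards [(S p.1).sys.locPow_move p.2] with x ⟨a, ha⟩
    filter_upwards [ha] with y hy using ⟨a, hy⟩
  have h3 : ∀ p : (n : ℕ) × (Fin (S n).len → Bool), ∀ᵐ x ∂μ, ∀ᶠ y in 𝓝 x,
      (S p.1).sys.idx ((S p.1).sys.move p.2 y) = p.2 := by
    intro p
    refine AELocConst.ae_eventually
      (((hidx p.1).comp_locPow hmp ((S p.1).sys.locPow_move p.2)).comp (· = p.2)) ?_
    filter_upwards [(S p.1).sys.ae_identities_univ] with x hx using hx.idx_move _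
  have h4 : ∀ n, ∀ᵐ x ∂μ, ∀ᶠ y in 𝓝 x, ∀ i (h : i < (S n).len) (h' : i < (S (n + 1)).len),
      (S (n + 1)).sys.idx y ⟨i, h'⟩ = (S n).sys.idx y ⟨i, h⟩ := by
    intro n
    refine AELocConst.ae_eventually ((hidx n).comp₂ (hidx (n + 1)) fun v v' =>
      ∀ i (h : i < (S n).len) (h' : i < (S (n + 1)).len), v' ⟨i, h'⟩ = v ⟨i, h⟩) ?_
    filter_upwards [(hS n).idx_eq] with x hx i h h' using hx ⟨i, h⟩
  have h5 : ∀ p : (n : ℕ) × (Fin (S n).len → Bool), ∀ᵐ x ∂μ, ∀ᶠ y in 𝓝 x,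
      (S p.1).sys.move p.2 y =
        (S (p.1 + 1)).sys.move (overwrite p.2 ((S (p.1 + 1)).sys.idx y)) y := by
    intro p
    have hloc : AELocPow T μ fun x =>
        (S (p.1 + 1)).sys.move (overwrite p.2 ((S (p.1 + 1)).sys.idx x)) x :=
      AELocPow.glue ((hidx (p.1 + 1)).comp fun v => overwrite p.2 v)
        (σ := (S (p.1 + 1)).sys.move) (S (p.1 + 1)).sys.locPow_move
    filter_upwards [AELocPow.eventually_eq hap ((S p.1).sys.locPow_move p.2) hloc,
      (hS p.1).move_eq] with x hx hx' using hx (hx' p.2)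
  have h6 : ∀ᵐ x ∂μ, ∀ᶠ y in 𝓝 x, ∃ n, (S n).sys.move ((S n).sys.idx (T y)) y = T y := by
    have hTp : AELocPow T μ T := by simpa using AELocPow.zpow (T := T) (μ := μ) 1
    have hloc : ∀ n, AELocPow T μ fun x => (S n).sys.move ((S n).sys.idx (T x)) x := fun n =>
      AELocPow.glue ((hidx n).comp_locPow hmp hTp) (σ := (S n).sys.move) (S n).sys.locPow_move
    filter_upwards [ae_all_iff.2 fun n => AELocPow.eventually_eq hap (hloc n) hTp, hrel]
      with x hx ⟨n, hn⟩
    filter_upwards [hx n (not_not.1 hn)] with y hy using ⟨n, hy⟩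
  have h7 : ∀ m, ∀ᵐ x ∂μ, ∀ᶠ y in 𝓝 x, ∃ n, Decides μ (S n).sys.idx (U m) ((S n).sys.idx y) := by
    intro m
    filter_upwards [ae_all_iff.2 hidx, hdec m] with x hx ⟨n, hn⟩
    filter_upwards [hx n] with y hy
    exact ⟨n, hy ▸ not_not.1 hn⟩
  have h8 : ∀ p : ℕ × ℕ, ∀ᵐ x ∂μ, ∀ᶠ y in 𝓝 x,
      (∀ᵐ z ∂μ, (S p.1).sys.idx z = (S p.1).sys.idx y → z ∈ U p.2) → y ∈ U p.2 := by
    intro p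
    refine AELocConst.ae_eventually ((hidx p.1).comp₂ (hU p.2) fun w q =>
      (∀ᵐ z ∂μ, (S p.1).sys.idx z = w → z ∈ U p.2) → q) ?_
    have : ∀ᵐ x ∂μ, ∀ w, (∀ᵐ z ∂μ, (S p.1).sys.idx z = w → z ∈ U p.2) →
        (S p.1).sys.idx x = w → x ∈ U p.2 := ae_all_iff.2 fun w => by
      by_cases h : ∀ᵐ z ∂μ, (S p.1).sys.idx z = w → z ∈ U p.2
      · filter_upwards [h] with x hx _ using hx
      · exact Eventually.of_forall fun x h' => absurd h' h
    filter_upwards [this] with x hx h using hx _ h rfl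
  have h9 : ∀ p : ℕ × ℕ, ∀ᵐ x ∂μ, ∀ᶠ y in 𝓝 x,
      (∀ᵐ z ∂μ, (S p.1).sys.idx z = (S p.1).sys.idx y → z ∉ U p.2) → y ∉ U p.2 := by
    intro p
    refine AELocConst.ae_eventually ((hidx p.1).comp₂ (hU p.2).not fun w q =>
      (∀ᵐ z ∂μ, (S p.1).sys.idx z = w → z ∉ U p.2) → q) ?_
    have : ∀ᵐ x ∂μ, ∀ w, (∀ᵐ z ∂μ, (S p.1).sys.idx z = w → z ∉ U p.2) →
        (S p.1).sys.idx x = w → x ∉ U p.2 := ae_all_iff.2 fun w => by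
      by_cases h : ∀ᵐ z ∂μ, (S p.1).sys.idx z = w → z ∉ U p.2
      · filter_upwards [h] with x hx _ using hx
      · exact Eventually.of_forall fun x h' => absurd h' h
    filter_upwards [this] with x hx h using hx _ h rfl
  obtain ⟨Y₁, hY₁, g1⟩ := exists_invariantGdeltaFull hmp h1
  obtain ⟨Y₂, hY₂, g2⟩ := exists_invariantGdeltaFull hmp h2
  obtain ⟨Y₃, hY₃, g3⟩ := exists_invariantGdeltaFull hmp h3
  obtain ⟨Y₄, hY₄, g4⟩ := exists_invariantGdeltaFull hmp h4
  obtain ⟨Y₅, hY₅, g5⟩ := exists_invariantGdeltaFull hmp h5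
  obtain ⟨Y₆, hY₆, g6⟩ := exists_invariantGdeltaFull hmp fun _ : Unit => h6
  obtain ⟨Y₇, hY₇, g7⟩ := exists_invariantGdeltaFull hmp h7
  obtain ⟨Y₈, hY₈, g8⟩ := exists_invariantGdeltaFull hmp h8
  obtain ⟨Y₉, hY₉, g9⟩ := exists_invariantGdeltaFull hmp h9
  have hinter : ∀ {A B : Set X}, IsInvariantGdeltaFull T μ A → IsInvariantGdeltaFull T μ B →
      IsInvariantGdeltaFull T μ (A ∩ B) := fun {A B} hA hB =>
    ⟨hA.isGδ.inter hB.isGδ, by rw [image_inter T.injective, hA.invariant, hB.invariant],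
      by rw [compl_inter]; exact measure_union_null hA.full hB.full⟩
  refine ⟨Y₁ ∩ (Y₂ ∩ (Y₃ ∩ (Y₄ ∩ (Y₅ ∩ (Y₆ ∩ (Y₇ ∩ (Y₈ ∩ Y₉))))))),
    hinter hY₁ (hinter hY₂ (hinter hY₃ (hinter hY₄ (hinter hY₅ (hinter hY₆
      (hinter hY₇ (hinter hY₈ hY₉))))))), ?_⟩
  rintro x ⟨x1, x2, x3, x4, x5, x6, x7, x8, x9⟩
  exact ⟨g1 x x1, fun n w => g2 x x2 ⟨n, w⟩, fun n w => g3 x x3 ⟨n, w⟩, g4 x x4,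
    fun n w => g5 x x5 ⟨n, w⟩, g6 x x6 (), g7 x x7, fun n m => g8 x x8 (n, m),
    fun n m => g9 x x9 (n, m)⟩

end Coding

/-! ### Coding by binary sequences -/

section Coding

variable {X : Type*} [TopologicalSpace X] [PolishSpace X] [MeasurableSpace X] [BorelSpace X]
  {μ : Measure X} {T : X ≃ₜ X}

lemma overwrite_apply_lt {d d' : ℕ} (w : Fin d → Bool) (v : Fin d' → Bool) {i : ℕ} (h : i < d)
    (h' : i < d') : overwrite w v ⟨i, h'⟩ = w ⟨i, h⟩ := by simp [overwrite, h]

lemma overwrite_apply_ge {d d' : ℕ} (w : Fin d → Bool) (v : Fin d' → Bool) {i : ℕ} (h : d ≤ i)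
    (h' : i < d') : overwrite w v ⟨i, h'⟩ = v ⟨i, h'⟩ := by simp [overwrite, h]

/-- The indices in a refining sequence of stages whose `n`-th word length is at least `n`, as one
infinite binary sequence. -/
def code (S : ℕ → Stage T μ) (hlen : ∀ n, n ≤ (S n).len) (x : X) : ℕ → Bool :=
  fun i => (S (i + 1)).sys.idx x ⟨i, hlen (i + 1)⟩

namespace GoodPoint

variable {S : ℕ → Stage T μ} {U : ℕ → Set X} {x : X}

lemma idx_eq_of_le (hx : GoodPoint S U x) (hmono : StrictMono fun n => (S n).len) {n m i : ℕ}
    (hnm : n ≤ m) (h : i < (S n).len) (h' : i < (S m).len) :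
    (S m).sys.idx x ⟨i, h'⟩ = (S n).sys.idx x ⟨i, h⟩ := by
  induction m, hnm using Nat.le_induction with
  | base => rfl
  | succ m hnm ih =>
    have hm : i < (S m).len := h.trans_le (hmono.monotone hnm)
    rw [hx.idx_succ m i hm h', ih hm]

lemma code_eq (hx : GoodPoint S U x) (hmono : StrictMono fun n => (S n).len)
    (hlen : ∀ n, n ≤ (S n).len) {n i : ℕ} (h : i < (S n).len) :
    code S hlen x i = (S n).sys.idx x ⟨i, h⟩ := by
  rcases le_total n (i + 1) with hle | hle
  · exact hx.idx_eq_of_le hmono hle h _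
  · exact (hx.idx_eq_of_le hmono hle _ h).symm

lemma move_eq_of_le (hx : GoodPoint S U x) (hmono : StrictMono fun n => (S n).len) {n m : ℕ}
    (hnm : n ≤ m) (w : Fin (S n).len → Bool) :
    (S n).sys.move w x = (S m).sys.move (overwrite w ((S m).sys.idx x)) x := by
  induction m, hnm using Nat.le_induction with
  | base =>
    congr 1
    ext i
    simp [overwrite]
  | succ m hnm ih =>
    rw [ih, hx.move_succ]
    congr 1
    ext ⟨i, hi⟩
    rcases lt_or_ge i (S m).len with h | h
    · rw [overwrite_apply_lt _ _ h]
      rcases lt_or_ge i (S n).len with h' | h'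
      · rw [overwrite_apply_lt _ _ h', overwrite_apply_lt _ _ h']
      · rw [overwrite_apply_ge _ _ h', overwrite_apply_ge _ _ h', hx.idx_succ m i h hi]
    · rw [overwrite_apply_ge _ _ h, overwrite_apply_ge _ _ ((hmono.monotone hnm).trans h)]

/-- Moving within a stage changes the code only in the letters belonging to this stage. -/
lemma code_move (hx : GoodPoint S U x) (hmono : StrictMono fun n => (S n).len)
    (hlen : ∀ n, n ≤ (S n).len) {n : ℕ} (w : Fin (S n).len → Bool)
    (hy : GoodPoint S U ((S n).sys.move w x)) (i : ℕ) :
    code S hlen ((S n).sys.move w x) i =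
      if h : i < (S n).len then w ⟨i, h⟩ else code S hlen x i := by
  set m := max n (i + 1)
  have hi : i < (S m).len := (Nat.lt_of_succ_le (le_max_right n (i + 1))).trans_le (hlen m)
  rw [hy.code_eq hmono hlen hi, hx.code_eq hmono hlen hi,
    hx.move_eq_of_le hmono (le_max_left n (i + 1)) w, hx.idx_move]
  rfl

end GoodPoint

/-- All initial segments of the index have the same probability: moving within the classes of the
stage exchanges them. -/
lemma Stage.measure_prefix_le (hT : MeasurePreserving T μ μ) (S : Stage T μ) {d : ℕ}
    (hd : d ≤ S.len) (w v : Fin d → Bool) :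
    μ {x | ∀ i : Fin d, S.sys.idx x (Fin.castLE hd i) = w i} ≤
      μ {x | ∀ i : Fin d, S.sys.idx x (Fin.castLE hd i) = v i} := by
  have hloc : ∀ u : Fin d → Bool,
      AELocPow T μ fun x => S.sys.move (overwrite u (S.sys.idx x)) x := fun u =>
    AELocPow.glue (S.sys.locConst_idx.comp fun t => overwrite u t)
      (σ := S.sys.move) S.sys.locPow_move
  refine (hloc v).measure_le hT (τ := fun x => S.sys.move (overwrite w (S.sys.idx x)) x)
    (S.sys.locConst_idx.comp
      fun t => ∀ i : Fin d, t (Fin.castLE hd i) = w i).nullMeasurableSet_setOf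
    ?_
  filter_upwards [S.sys.ae_identities_univ] with x hx hxw
  refine ⟨fun i => ?_, ?_⟩
  · rw [hx.idx_move]
    exact overwrite_apply_lt _ _ i.2 _
  · have : overwrite w (overwrite v (S.sys.idx x)) = S.sys.idx x := by
      ext ⟨i, hi⟩
      rcases lt_or_ge i d with h | h
      · rw [overwrite_apply_lt _ _ h]
        exact (hxw ⟨i, h⟩).symm
      · rw [overwrite_apply_ge _ _ h, overwrite_apply_ge _ _ h]
    simp only [hx.idx_move, hx.move_move, this, hx.move_idx]

lemma IsInvariantGdeltaFull.zpow_mem {X' : Set X} (h : IsInvariantGdeltaFull T μ X') {x : X}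
    (hx : x ∈ X') (n : ℤ) : (T ^ n) x ∈ X' := by
  have hfwd : ∀ y, T y ∈ X' ↔ y ∈ X' := fun y => by
    conv_lhs => rw [← h.invariant]
    exact T.injective.mem_set_image
  have hstep : ∀ m : ℤ, (T ^ (m + 1)) x ∈ X' ↔ (T ^ m) x ∈ X' := fun m => by
    rw [add_comm, homeo_zpow_add_apply, zpow_one, hfwd]
  induction n with
  | zero => simpa using hx
  | succ n ih => exact (hstep n).2 ih
  | pred n ih =>
    refine (hstep _).1 ?_
    rwa [sub_add_cancel]

/-- The map `φ` codes the points of an invariant `G_δ` set `X'` of full measure by binary sequences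
in such a way that orbits correspond to classes of eventual equality, and all words of a given length
occur as prefixes with the same probability. -/
structure IsCoding (T : X ≃ₜ X) (μ : Measure X) (X' : Set X) (φ : X → ℕ → Bool) : Prop where
  full : IsInvariantGdeltaFull T μ X'
  isEmbedding : IsEmbedding fun x : X' => φ x
  orbit : ∀ x ∈ X', ∀ z, (∃ y ∈ homeoOrbit T x, φ y = z) ↔ z =ᶠ[atTop] φ x
  prefix_eq : ∀ (d : ℕ) (w v : Fin d → Bool),
    μ {x | x ∈ X' ∧ ∀ i : Fin d, φ x i = w i} = μ {x | x ∈ X' ∧ ∀ i : Fin d, φ x i = v i}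

theorem exists_isCoding [IsProbabilityMeasure μ] [NullSingletonClass μ] (hT : Ergodic T μ) :
    ∃ (X' : Set X) (φ : X → ℕ → Bool), IsCoding T μ X' φ := by
  have hmp := hT.toMeasurePreserving
  obtain ⟨U, -, hUf, hU⟩ := exists_base_null_frontier μ
  have hUc : ∀ n, AELocConst μ (· ∈ U n) := fun n => AELocConst.mem_of_null_frontier (hUf n)
  obtain ⟨S, hS, hdec, hrel⟩ := exists_stages hT hUc
  obtain ⟨X', hX', hgood⟩ := exists_goodPoints hT hUc hS hdec hrel
  have hmono : StrictMono fun n => (S n).len := strictMono_nat_of_lt_succ fun n => (hS n).lt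
  have hlen : ∀ n, n ≤ (S n).len := hmono.id_le
  have hmove : ∀ x ∈ X', ∀ n w, (S n).sys.move w x ∈ X' := by
    intro x hx n w
    obtain ⟨a, ha⟩ := (hgood x hx).move_orbit n w
    exact ha ▸ hX'.zpow_mem hx a
  refine ⟨X', code S hlen, hX', IsInducing.isEmbedding ?_, ?_, ?_⟩
  · refine isInducing_iff_nhds.2 fun ⟨x, hx⟩ => le_antisymm ?_ ?_
    · rw [← map_le_iff_le_comap]
      refine tendsto_pi_nhds.2 fun i => ?_
      refine tendsto_const_nhds.congr' ?_
      have := (hgood x hx).eventually_idx (i + 1)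
      filter_upwards [continuous_subtype_val.continuousAt.eventually this] with y hy
      change (S (i + 1)).sys.idx x _ = (S (i + 1)).sys.idx y _
      rw [hy]
    · intro V hV
      obtain ⟨V', hV', hVV⟩ := mem_nhds_induced _ _ _ |>.1 hV
      obtain ⟨m, hxm, hm⟩ := hU x V' hV'
      obtain ⟨n, hn⟩ := (hgood x hx).decided m
      have hn' : ∀ᵐ y ∂μ, (S n).sys.idx y = (S n).sys.idx x → y ∈ U m :=
        hn.resolve_right fun h => (hgood x hx).notMem_of_ae n m h hxm
      have hcyl : {z : ℕ → Bool | ∀ i ∈ Finset.range (S n).len, z i = code S hlen x i} ∈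
          𝓝 (code S hlen x) := by
        refine (Finset.eventually_all _).2 fun i _ => ?_
        exact (continuous_apply i).continuousAt.eventually
          ((isOpen_discrete {code S hlen x i}).mem_nhds rfl)
      refine mem_comap.2 ⟨_, hcyl, fun ⟨y, hy⟩ hyz => hVV (hm ?_)⟩
      have hyx : (S n).sys.idx y = (S n).sys.idx x := by
        ext ⟨i, hi⟩
        rw [← (hgood y hy).code_eq hmono hlen hi, ← (hgood x hx).code_eq hmono hlen hi]
        exact hyz i (Finset.mem_range.2 hi)
      exact (hgood y hy).mem_of_ae n m (by rwa [hyx])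
  · intro x hx z
    constructor
    · have hstep : ∀ y ∈ X', code S hlen (T y) =ᶠ[atTop] code S hlen y := by
        intro y hy
        obtain ⟨n, hn⟩ := (hgood y hy).related
        filter_upwards [eventually_ge_atTop (S n).len] with i hi
        have := (hgood y hy).code_move hmono hlen ((S n).sys.idx (T y))
          (hgood _ (hmove y hy n _)) i
        rwa [hn, dif_neg (not_lt.2 hi)] at this
      rintro ⟨y, ⟨k, rfl⟩, rfl⟩
      induction k with
      | zero => simp
      | succ k ih =>
        rw [add_comm, homeo_zpow_add_apply, zpow_one]
        exact (hstep _ (hX'.zpow_mem hx _)).trans ih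
      | pred k ih =>
        have h1 := homeo_zpow_add_apply T 1 (-(k : ℤ) - 1) x
        rw [zpow_one, show (1 : ℤ) + (-k - 1) = -k by ring] at h1
        have h2 := hstep _ (hX'.zpow_mem hx (-(k : ℤ) - 1))
        rw [← h1] at h2
        exact h2.symm.trans ih
    · intro hz
      obtain ⟨N, hN⟩ := eventually_atTop.1 hz
      refine ⟨(S N).sys.move (fun i => z i) x, ?_, ?_⟩
      · obtain ⟨a, ha⟩ := (hgood x hx).move_orbit N fun i => z i
        exact ⟨a, ha.symm⟩
      · ext i
        rw [(hgood x hx).code_move hmono hlen _ (hgood _ (hmove x hx N _))]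
        split_ifs with h
        · rfl
        · exact (hN i ((hlen N).trans (not_lt.1 h))).symm
  · have hae : ∀ (d : ℕ) (w : Fin d → Bool),
        μ {x | x ∈ X' ∧ ∀ i : Fin d, code S hlen x i = w i} =
          μ {x | ∀ i : Fin d, (S d).sys.idx x (Fin.castLE (hlen d) i) = w i} := by
      intro d w
      apply measure_congr
      filter_upwards [measure_eq_zero_iff_ae_notMem.1 hX'.full] with x hx
      have hx' : x ∈ X' := not_not.1 hx
      refine propext (Iff.trans (and_iff_right hx') (forall_congr' fun i => ?_))
      rw [(hgood x hx').code_eq hmono hlen (i.2.trans_le (hlen d))]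
      rfl
    intro d w v
    rw [hae, hae]
    exact le_antisymm (Stage.measure_prefix_le hmp _ _ _ _) (Stage.measure_prefix_le hmp _ _ _ _)

end Coding

/-! ### Comparison through the space of binary sequences -/

section Model

/-- The image of a `G_δ` subset of a Polish space under an embedding into a metrizable space is
again a `G_δ` set. -/
lemma isGδ_image_of_isEmbedding {X Z : Type*} [TopologicalSpace X] [PolishSpace X]
    [TopologicalSpace Z] [MetrizableSpace Z] {X' : Set X} (hX' : IsGδ X') {φ : X → Z}
    (hφ : IsEmbedding fun x : X' => φ x) : IsGδ (φ '' X') := by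
  let := upgradeIsCompletelyMetrizable X
  let := metrizableSpaceMetric Z
  obtain ⟨O, hO, rfl⟩ := isGδ_iff_eq_iInter_nat.1 hX'
  set X' : Set X := ⋂ n, O n
  -- open sets whose preimage is small and has its closure inside `O m`
  set G : ℕ → Set Z := fun m => ⋃₀ {W | IsOpen W ∧
    (∀ x ∈ X', ∀ y ∈ X', φ x ∈ W → φ y ∈ W → dist x y < 1 / (m + 1)) ∧
    closure {x | x ∈ X' ∧ φ x ∈ W} ⊆ O m}
  have hG : ∀ m, IsOpen (G m) := fun m => isOpen_sUnion fun W hW => hW.1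
  suffices h : φ '' X' = closure (φ '' X') ∩ ⋂ m, G m by
    rw [h]
    exact isClosed_closure.isGδ.inter (.iInter fun m => (hG m).isGδ)
  apply Subset.antisymm
  · rintro _ ⟨x, hx, rfl⟩
    refine ⟨subset_closure ⟨x, hx, rfl⟩, mem_iInter.2 fun m => ?_⟩
    obtain ⟨r, hr, hrO⟩ := Metric.mem_nhds_iff.1 ((hO m).mem_nhds (mem_iInter.1 hx m))
    set ρ : ℝ := min (r / 2) (1 / (m + 1) / 2)
    have hm : (0 : ℝ) < 1 / (m + 1) := Nat.one_div_pos_of_nat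
    have hρ : 0 < ρ := lt_min (half_pos hr) (half_pos hm)
    have hnhd : Subtype.val ⁻¹' Metric.ball x ρ ∈ 𝓝 (⟨x, hx⟩ : X') :=
      continuous_subtype_val.continuousAt.preimage_mem_nhds (Metric.ball_mem_nhds x hρ)
    rw [hφ.isInducing.nhds_eq_comap] at hnhd
    obtain ⟨W', hW', hsub⟩ := mem_comap.1 hnhd
    obtain ⟨W, hWW', hWo, hxW⟩ := mem_nhds_iff.1 hW'
    have hball : ∀ y ∈ X', φ y ∈ W → dist y x < ρ := fun y hy hyW =>
      hsub (show (⟨y, hy⟩ : X') ∈ _ from hWW' hyW)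
    refine ⟨W, ⟨hWo, fun y hy z hz hyW hzW => ?_, ?_⟩, hxW⟩
    · have h1 := hball y hy hyW
      have h2 := hball z hz hzW
      have h3 := dist_triangle_right y z x
      have h4 : ρ ≤ 1 / (m + 1) / 2 := min_le_right _ _
      linarith
    · have h1 : closure {y | y ∈ X' ∧ φ y ∈ W} ⊆ Metric.closedBall x ρ :=
        closure_minimal (fun y hy => (hball y hy.1 hy.2).le) Metric.isClosed_closedBall
      refine h1.trans ((Metric.closedBall_subset_ball ?_).trans hrO)
      exact (min_le_left _ _).trans_lt (half_lt_self hr)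
  · rintro z ⟨hz, hzG⟩
    set F : Filter X' := comap (fun x : X' => φ x) (𝓝 z)
    have hF : F.NeBot := by
      refine comap_neBot fun t ht => ?_
      obtain ⟨_, hzt, x, hx, rfl⟩ := mem_closure_iff_nhds.1 hz t ht
      exact ⟨⟨x, hx⟩, hzt⟩
    have hFm : ∀ m : ℕ, ∃ W : Set Z, W ∈ 𝓝 z ∧
        (∀ x ∈ X', ∀ y ∈ X', φ x ∈ W → φ y ∈ W → dist x y < 1 / (m + 1 : ℝ)) ∧
        closure {x | x ∈ X' ∧ φ x ∈ W} ⊆ O m := by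
      intro m
      obtain ⟨W, ⟨h1, h2, h3⟩, hzW⟩ := mem_iInter.1 hzG m
      exact ⟨W, h1.mem_nhds hzW, h2, h3⟩
    have hmem : ∀ W ∈ 𝓝 z, {x | x ∈ X' ∧ φ x ∈ W} ∈ map Subtype.val F := fun W hW =>
      mem_map.2 (mem_comap.2 ⟨W, hW, fun x hx => ⟨x.2, hx⟩⟩)
    have hcauchy : Cauchy (map Subtype.val F) := by
      refine Metric.cauchy_iff.2 ⟨inferInstance, fun ε hε => ?_⟩
      obtain ⟨m, hm⟩ := exists_nat_one_div_lt hε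
      obtain ⟨W, hW, h2, -⟩ := hFm m
      exact ⟨_, hmem W hW, fun x hx y hy => (h2 x hx.1 y hy.1 hx.2 hy.2).trans hm⟩
    obtain ⟨x, hx⟩ := CompleteSpace.complete hcauchy
    have hxX : x ∈ X' := by
      refine mem_iInter.2 fun m => ?_
      obtain ⟨W, hW, -, h3⟩ := hFm m
      exact h3 (mem_closure_of_tendsto (tendsto_id'.2 hx) (hmem W hW))
    refine ⟨x, hxX, ?_⟩
    have hFx : F ≤ 𝓝 (⟨x, hxX⟩ : X') := by
      rw [nhds_subtype_eq_comap]
      exact map_le_iff_le_comap.1 hx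
    have h1 : Tendsto (fun y : X' => φ y) F (𝓝 (φ x)) :=
      (hφ.continuous.tendsto (⟨x, hxX⟩ : X')).mono_left hFx
    exact tendsto_nhds_unique h1 tendsto_comap

/-- The sequences with a given prefix. -/
def prefixSet {d : ℕ} (w : Fin d → Bool) : Set (ℕ → Bool) := {z | ∀ i : Fin d, z i = w i}

lemma measurableSet_prefixSet {d : ℕ} (w : Fin d → Bool) : MeasurableSet (prefixSet w) := by
  have : prefixSet w = ⋂ i : Fin d, (fun z : ℕ → Bool => z i) ⁻¹' {w i} := by
    ext z; simp [prefixSet]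
  rw [this]
  exact .iInter fun i => measurable_pi_apply _ (measurableSet_singleton _)

/-- A probability measure on the space of binary sequences for which all prefixes of the same length
have the same probability is determined by this property. -/
lemma measure_eq_of_prefix_eq {m m' : Measure (ℕ → Bool)} [IsProbabilityMeasure m]
    [IsProbabilityMeasure m']
    (hm : ∀ (d : ℕ) (w v : Fin d → Bool), m (prefixSet w) = m (prefixSet v))
    (hm' : ∀ (d : ℕ) (w v : Fin d → Bool), m' (prefixSet w) = m' (prefixSet v)) : m = m' := by
  have hval : ∀ (p : Measure (ℕ → Bool)) [IsProbabilityMeasure p],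
      (∀ (d : ℕ) (w v : Fin d → Bool), p (prefixSet w) = p (prefixSet v)) →
      ∀ (d : ℕ) (w : Fin d → Bool), p (prefixSet w) = ((2 ^ d : ℕ) : ENNReal)⁻¹ := by
    intro p _ hp d w
    have hU : (univ : Set (ℕ → Bool)) = ⋃ v : Fin d → Bool, prefixSet v := by
      symm
      exact iUnion_eq_univ_iff.2 fun z => ⟨fun i => z i, fun i => rfl⟩
    have h1 : (1 : ENNReal) = ((2 ^ d : ℕ) : ENNReal) * p (prefixSet w) := by
      rw [← measure_univ (μ := p), hU, measure_iUnion _ fun v => measurableSet_prefixSet v,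
        tsum_fintype, Finset.sum_congr rfl fun v _ => hp d v w]
      · simp
      · intro v v' hne
        refine Set.disjoint_left.2 fun z hz hz' => hne (funext fun i => ?_)
        exact (hz i).symm.trans (hz' i)
    exact ENNReal.eq_inv_of_mul_eq_one_left (by rw [mul_comm]; exact h1.symm)
  set C : Set (Set (ℕ → Bool)) := {s | ∃ (d : ℕ) (w : Fin d → Bool), s = prefixSet w}
  have hgen : (MeasurableSpace.pi : MeasurableSpace (ℕ → Bool)) =
      MeasurableSpace.generateFrom C := by
    apply le_antisymm
    · refine iSup_le fun i => ?_
      rintro _ ⟨s, -, rfl⟩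
      have : (fun z : ℕ → Bool => z i) ⁻¹' s =
          ⋃ w : {w : Fin (i + 1) → Bool // w (Fin.last i) ∈ s}, prefixSet w.1 := by
        ext z
        simp only [mem_preimage, mem_iUnion]
        constructor
        · exact fun h => ⟨⟨fun j => z j, h⟩, fun j => rfl⟩
        · rintro ⟨w, hw⟩
          have := hw (Fin.last i)
          rw [Fin.val_last] at this
          exact this ▸ w.2
      rw [this]
      exact MeasurableSet.iUnion fun w => MeasurableSpace.measurableSet_generateFrom ⟨_, _, rfl⟩
    · refine MeasurableSpace.generateFrom_le ?_
      rintro _ ⟨d, w, rfl⟩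
      exact measurableSet_prefixSet w
  have hpi : IsPiSystem C := by
    have key : ∀ {d d' : ℕ} (w : Fin d → Bool) (w' : Fin d' → Bool), d ≤ d' →
        (prefixSet w ∩ prefixSet w').Nonempty → prefixSet w ∩ prefixSet w' = prefixSet w' := by
      rintro d d' w w' hd ⟨z, hz, hz'⟩
      refine inter_eq_right.2 fun y hy i => ?_
      rw [← hz i]
      exact (hy (Fin.castLE hd i)).trans (hz' (Fin.castLE hd i)).symm
    rintro _ ⟨d, w, rfl⟩ _ ⟨d', w', rfl⟩ hne
    rcases le_total d d' with h | h
    · exact ⟨d', w', key w w' h hne⟩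
    · exact ⟨d, w, by rw [inter_comm] at hne ⊢; exact key w' w h hne⟩
  refine ext_of_generate_finite C hgen hpi ?_ (by simp)
  rintro _ ⟨d, w, rfl⟩
  rw [hval m hm, hval m' hm']

end Model

section Transfer

variable {X Y : Type*} [TopologicalSpace X] [PolishSpace X] [MeasurableSpace X] [BorelSpace X]
  [TopologicalSpace Y] [PolishSpace Y] [MeasurableSpace Y] [BorelSpace Y]
  {μ : Measure X} {ν : Measure Y} {T : X ≃ₜ X} {S : Y ≃ₜ Y}

namespace IsCoding

variable {X₁ : Set X} {φ : X → ℕ → Bool} {Y₁ : Set Y} {ψ : Y → ℕ → Bool}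

lemma mem_of_mem_homeoOrbit (h : IsCoding T μ X₁ φ) {x y : X} (hx : x ∈ X₁)
    (hy : y ∈ homeoOrbit T x) : y ∈ X₁ := by
  obtain ⟨n, rfl⟩ := hy
  exact h.full.zpow_mem hx n

lemma injOn (h : IsCoding T μ X₁ φ) : InjOn φ X₁ := fun x hx y hy hxy =>
  congrArg Subtype.val (h.isEmbedding.injective (a₁ := ⟨x, hx⟩) (a₂ := ⟨y, hy⟩) hxy)

/-- The distribution of the codes. -/
noncomputable def law (μ : Measure X) (X₁ : Set X) (φ : X → ℕ → Bool) : Measure (ℕ → Bool) :=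
  (μ.comap ((↑) : X₁ → X)).map fun x : X₁ => φ x

lemma law_apply (h : IsCoding T μ X₁ φ) {A : Set (ℕ → Bool)} (hA : MeasurableSet A) :
    law μ X₁ φ A = μ {x | x ∈ X₁ ∧ φ x ∈ A} := by
  rw [law, Measure.map_apply h.isEmbedding.continuous.measurable hA,
    comap_subtype_coe_apply h.full.isGδ.measurableSet]
  congr 1
  ext x
  simp [and_comm]

lemma comap_apply (h : IsCoding T μ X₁ φ) {X' : Set X} (hX' : IsInvariantGdeltaFull T μ X')
    (hsub : X' ⊆ X₁) {A : Set (ℕ → Bool)} (hA : MeasurableSet A) :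
    μ.comap ((↑) : X' → X) ((fun x : X' => φ x) ⁻¹' A) = law μ X₁ φ A := by
  rw [comap_subtype_coe_apply hX'.isGδ.measurableSet, h.law_apply hA]
  apply measure_congr
  filter_upwards [measure_eq_zero_iff_ae_notMem.1 hX'.full] with x hx
  have hx' : x ∈ X' := not_not.1 hx
  refine propext ⟨?_, fun hxA => ⟨⟨x, hx'⟩, hxA.2, rfl⟩⟩
  rintro ⟨y, hy, rfl⟩
  exact ⟨hsub y.2, hy⟩

lemma isProbabilityMeasure_law [IsProbabilityMeasure μ] (h : IsCoding T μ X₁ φ) :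
    IsProbabilityMeasure (law μ X₁ φ) := by
  constructor
  rw [h.law_apply .univ]
  simp only [mem_univ, and_true]
  exact (prob_compl_eq_zero_iff h.full.isGδ.measurableSet).1 h.full.full

lemma law_eq_law [IsProbabilityMeasure μ] [IsProbabilityMeasure ν] (h : IsCoding T μ X₁ φ)
    (h' : IsCoding S ν Y₁ ψ) : law μ X₁ φ = law ν Y₁ ψ := by
  have := h.isProbabilityMeasure_law
  have := h'.isProbabilityMeasure_law
  refine measure_eq_of_prefix_eq (fun d w v => ?_) (fun d w v => ?_)
  · rw [h.law_apply (measurableSet_prefixSet _), h.law_apply (measurableSet_prefixSet _)]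
    exact h.prefix_eq d w v
  · rw [h'.law_apply (measurableSet_prefixSet _), h'.law_apply (measurableSet_prefixSet _)]
    exact h'.prefix_eq d w v

/-- The points of `X₁` whose code is also the code of a point of `Y₁` form an invariant `G_δ` set of
full measure. -/
lemma common_full [IsProbabilityMeasure μ] [IsProbabilityMeasure ν] (h : IsCoding T μ X₁ φ)
    (h' : IsCoding S ν Y₁ ψ) :
    IsInvariantGdeltaFull T μ {x | x ∈ X₁ ∧ φ x ∈ ψ '' Y₁} := by
  have hH := isGδ_image_of_isEmbedding h'.full.isGδ h'.isEmbedding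
  have horb : ∀ x, x ∈ X₁ ∧ φ x ∈ ψ '' Y₁ → ∀ n : ℤ, (T ^ n) x ∈ X₁ ∧ φ ((T ^ n) x) ∈ ψ '' Y₁ := by
    rintro x ⟨hx, y, hy, hyx⟩ n
    refine ⟨h.full.zpow_mem hx n, ?_⟩
    have h1 := (h.orbit x hx _).1 ⟨(T ^ n) x, ⟨n, rfl⟩, rfl⟩
    rw [← hyx] at h1
    obtain ⟨y', hy', hyy'⟩ := (h'.orbit y hy _).2 h1
    exact ⟨y', h'.mem_of_mem_homeoOrbit hy hy', hyy'⟩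
  have hG : IsGδ {x | x ∈ X₁ ∧ φ x ∈ ψ '' Y₁} := by
    obtain ⟨O, hO, hOH⟩ := isGδ_iff_eq_iInter_nat.1 hH
    have hpre : ∀ n, ∃ V : Set X, IsOpen V ∧ ∀ x ∈ X₁, (x ∈ V ↔ φ x ∈ O n) := by
      intro n
      obtain ⟨V, hV, hVO⟩ := isOpen_induced_iff.1 ((hO n).preimage h.isEmbedding.continuous)
      exact ⟨V, hV, fun x hx => Set.ext_iff.1 hVO ⟨x, hx⟩⟩
    choose V hV hVO using hpre
    have : {x | x ∈ X₁ ∧ φ x ∈ ψ '' Y₁} = X₁ ∩ ⋂ n, V n := by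
      ext x
      rw [hOH]
      simp only [mem_ofPred_eq, mem_inter_iff, mem_iInter]
      exact and_congr_right fun hx => forall_congr' fun n => (hVO n x hx).symm
    rw [this]
    exact h.full.isGδ.inter (.iInter fun n => (hV n).isGδ)
  refine ⟨hG, ?_, ?_⟩
  · ext x
    constructor
    · rintro ⟨y, hy, rfl⟩
      simpa using horb y hy 1
    · intro hx
      refine ⟨(T ^ (-1 : ℤ)) x, horb x hx (-1), ?_⟩
      rw [zpow_neg_one]
      exact T.apply_symm_apply x
  · have hlaw := congrArg (fun m => m (ψ '' Y₁)) (h.law_eq_law h')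
    simp only [h.law_apply hH.measurableSet, h'.law_apply hH.measurableSet] at hlaw
    have h1 : {y | y ∈ Y₁ ∧ ψ y ∈ ψ '' Y₁} = Y₁ := by
      ext y
      exact ⟨fun hy => hy.1, fun hy => ⟨hy, y, hy, rfl⟩⟩
    rw [h1, (prob_compl_eq_zero_iff h'.full.isGδ.measurableSet).1 h'.full.full] at hlaw
    exact (prob_compl_eq_zero_iff hG.measurableSet).2 hlaw

/-- Two codings are composed through the space of binary sequences. -/
theorem almostContinuousOrbitEquivalent [IsProbabilityMeasure μ] [IsProbabilityMeasure ν]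
    (h : IsCoding T μ X₁ φ) (h' : IsCoding S ν Y₁ ψ) :
    AlmostContinuousOrbitEquivalent T μ S ν := by
  set X' : Set X := {x | x ∈ X₁ ∧ φ x ∈ ψ '' Y₁}
  set Y' : Set Y := {y | y ∈ Y₁ ∧ ψ y ∈ φ '' X₁}
  have hX' : IsInvariantGdeltaFull T μ X' := h.common_full h'
  have hY' : IsInvariantGdeltaFull S ν Y' := h'.common_full h
  have hφ : IsEmbedding fun x : X' => φ x :=
    h.isEmbedding.comp (IsEmbedding.inclusion fun x hx => hx.1)
  have hψ : IsEmbedding fun y : Y' => ψ y :=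
    h'.isEmbedding.comp (IsEmbedding.inclusion fun y hy => hy.1)
  have hrange : range (fun x : X' => φ x) = range fun y : Y' => ψ y := by
    ext z
    constructor
    · rintro ⟨⟨x, hx, y, hy, hyx⟩, rfl⟩
      exact ⟨⟨y, hy, x, hx, hyx.symm⟩, hyx⟩
    · rintro ⟨⟨y, hy, x, hx, hxy⟩, rfl⟩
      exact ⟨⟨x, hx, y, hy, hxy.symm⟩, hxy⟩
  set Φ : X' ≃ₜ Y' := hφ.toHomeomorph.trans
    ((Homeomorph.setCongr hrange).trans hψ.toHomeomorph.symm)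
  have hΦ : ∀ x : X', ψ (Φ x) = φ x := by
    intro x
    have : hψ.toHomeomorph (Φ x) = Homeomorph.setCongr hrange (hφ.toHomeomorph x) :=
      hψ.toHomeomorph.apply_symm_apply _
    exact congrArg Subtype.val this
  refine ⟨X', Y', Φ, hX', hY', ⟨Φ.continuous.measurable, ?_⟩, fun x => ?_⟩
  · ext A hA
    -- a Borel set of `Y'` is the preimage of a Borel set of codes
    obtain ⟨B, hB, rfl⟩ : ∃ B, MeasurableSet B ∧ (fun y : Y' => ψ y) ⁻¹' B = A := by
      rwa [BorelSpace.measurable_eq (α := Y'), hψ.isInducing.eq_induced, borel_comap,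
        ← BorelSpace.measurable_eq (α := ℕ → Bool)] at hA
    rw [Measure.map_apply Φ.continuous.measurable (hψ.continuous.measurable hB)]
    have hpre : Φ ⁻¹' ((fun y : Y' => ψ y) ⁻¹' B) = (fun x : X' => φ x) ⁻¹' B := by
      ext x
      simp only [mem_preimage, hΦ]
    rw [hpre, h.comap_apply hX' (fun x hx => hx.1) hB, h.law_eq_law h',
      h'.comap_apply hY' (fun y hy => hy.1) hB]
  · have hx := x.2.1
    have hy := (Φ x).2.1
    ext y
    constructor
    · rintro ⟨z, hz, rfl⟩
      have h1 := (h.orbit x hx _).1 ⟨z, hz, rfl⟩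
      rw [← hΦ, ← hΦ] at h1
      obtain ⟨y', hy', hyz⟩ := (h'.orbit _ hy _).2 h1
      rwa [h'.injOn (h'.mem_of_mem_homeoOrbit hy hy') (Φ z).2.1 hyz] at hy'
    · intro hyo
      have hyY : y ∈ Y' := by
        obtain ⟨n, rfl⟩ := hyo
        exact hY'.zpow_mem (Φ x).2 n
      obtain ⟨z, hz⟩ := Φ.surjective ⟨y, hyY⟩
      have h1 := (h'.orbit _ hy _).1 ⟨y, hyo, rfl⟩
      rw [hΦ] at h1
      obtain ⟨x', hx', hxy⟩ := (h.orbit x hx _).2 h1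
      have h2 : φ x' = φ z := by rw [hxy, ← hΦ, hz]
      have h3 := h.injOn (h.mem_of_mem_homeoOrbit hx hx') z.2.1 h2
      refine ⟨z, ?_, congrArg Subtype.val hz⟩
      change (z : X) ∈ homeoOrbit T x
      rwa [← h3]

end IsCoding

end Transfer

theorem theorem1 :
    (∀ (X : Type u) (Y : Type v)
      [TopologicalSpace X] [PolishSpace X] [MeasurableSpace X] [BorelSpace X]
      [TopologicalSpace Y] [PolishSpace Y] [MeasurableSpace Y] [BorelSpace Y]
      (μ : Measure X) [IsProbabilityMeasure μ] [NullSingletonClass μ]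
      (ν : Measure Y) [IsProbabilityMeasure ν] [NullSingletonClass ν]
      (T : X ≃ₜ X) (S : Y ≃ₜ Y), Ergodic T μ → Ergodic S ν →
        AlmostContinuousOrbitEquivalent T μ S ν) ∧
    (∀ (X : Type u) (Y : Type v)
      [TopologicalSpace X] [PolishSpace X] [MeasurableSpace X] [BorelSpace X]
      [TopologicalSpace Y] [PolishSpace Y] [MeasurableSpace Y] [BorelSpace Y]
      (μ : Measure X) [IsProbabilityMeasure μ] [NullSingletonClass μ]
      (ν : Measure Y) [IsProbabilityMeasure ν] [NullSingletonClass ν]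
      (T : X ≃ₜ X) (S : Y ≃ₜ Y), Ergodic T μ → Ergodic S ν →
        IsFractured X → IsFractured Y →
        AlmostContinuousOrbitEquivalent T μ S ν) := by
  have key : ∀ (X : Type u) (Y : Type v)
      [TopologicalSpace X] [PolishSpace X] [MeasurableSpace X] [BorelSpace X]
      [TopologicalSpace Y] [PolishSpace Y] [MeasurableSpace Y] [BorelSpace Y]
      (μ : Measure X) [IsProbabilityMeasure μ] [NullSingletonClass μ]
      (ν : Measure Y) [IsProbabilityMeasure ν] [NullSingletonClass ν]
      (T : X ≃ₜ X) (S : Y ≃ₜ Y), Ergodic T μ → Ergodic S ν →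
        AlmostContinuousOrbitEquivalent T μ S ν := by
    intro X Y _ _ _ _ _ _ _ _ μ _ _ ν _ _ T S hT hS
    obtain ⟨X', φ, h⟩ := exists_isCoding hT
    obtain ⟨Y', ψ, h'⟩ := exists_isCoding hS
    exact h.almostContinuousOrbitEquivalent h'
  exact ⟨key, fun X Y _ _ _ _ _ _ _ _ μ _ _ ν _ _ T S hT hS _ _ => key X Y μ ν T S hT hS⟩
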